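/- **Proposition (Shen's Simon parabolic identity).** Let $M$ be a smooth manifold with boundary, let $J\subset\mathbb R$ be an interval, and let $g(t)$, $t\in J$, be a family of Riemannian metrics on $M$, smooth on $M\times J$ (up to the boundary), which solves the Ricci flow equation $\partial_t g=-2\,\mathrm{Ric}(g)$ on $M\times J$. Let $n=\nu$ be the ($g(t)$-dependent) outward unit normal of $\partial M$, let $h(X,Y)=g(\nabla_X\nu,Y)$ be the second fundamental form of $\partial M$, let Greek indices be the indices of boundary coordinates $\partial_\alpha$, and let $g^{\alpha\beta}$ denote the inverse of the metric $\overline g$ induced on $\partial M$. Put $H=g^{\alpha\beta}h_{\alpha\beta}$ and $|A|^2=g^{\alpha\gamma}g^{\beta\delta}h_{\alpha\beta}h_{\gamma\delta}$. A semicolon denotes covariant differentiation with respect to the Levi-Civita connection of $\overline g$ on $\partial M$ and a vertical bar covariant differentiation with respect to that of $g$ on $M$; $\Delta h_{\alpha\beta}=g^{\gamma\delta}h_{\alpha\beta;\gamma\delta}$ and $H_{\alpha\beta}=H_{;\alpha\beta}$. Let $R_{ijkl}=g(R(\partial_i,\partial_j)\partial_k,\partial_l)$, with $R(X,Y)=\nabla_X\nabla_Y-\nabla_Y\nabla_X-\nabla_{[X,Y]}$,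 be the Riemann tensor of $g$ (so that $R_{ijji}>0$ on round spheres, and $R_{jk}=g^{il}R_{ijkl}$), and write $R_{n\alpha\beta n}=\mathrm{Rm}(\nu,\partial_\alpha,\partial_\beta,\nu)$, $R_{n\alpha\beta n|n}=(\nabla_\nu \mathrm{Rm})(\nu,\partial_\alpha,\partial_\beta,\nu)$. Then, at every point of $\partial M$, in all coordinates adapted to the boundary (fixed in time), and at every time $t\in J$ (one-sided time derivative at an end point of $J$), $$ \begin{aligned} \frac{\partial}{\partial t}h_{\alpha\beta} ={}&\Delta h_{\alpha\beta}-H_{\alpha\beta}-R_{n\alpha\beta n|n}-H R_{n\alpha\beta n}\\ &-g^{\gamma\delta}g^{\rho\omega}h_{\beta\rho}R_{\alpha\delta\gamma\omega} -g^{\gamma\delta}g^{\rho\omega}h_{\delta\rho}R_{\beta\gamma\alpha\omega}\\ &-H g^{\rho\omega}h_{\beta\rho}h_{\omega\alpha}+|A|^2h_{\alpha\beta}\\ &-g^{\gamma\delta}g^{\rho\omega}\left(R_{\beta\delta\gamma\rho}h_{\omega\alpha}+R_{\beta\delta\alpha\rho}h_{\omega\gamma}\right)\\ &-g^{\gamma\delta}g^{\rho\omega}\left(h_{\beta\rho}h_{\delta\alpha}h_{\omega\gamma}-h_{\beta\gamma}h_{\delta\rho}h_{\omega\alpha}\right).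 \end{aligned} $$ -/

import Mathlib

open scoped Manifold ContDiff

noncomputable section

namespace BoundaryRicciFlow

/-- Coordinate space of dimension `d`. -/
abbrev Coord (d : ℕ) : Type := EuclideanSpace ℝ (Fin d)

/-- The closed half-space `{y | 0 ≤ y⁰}`, the range of the model with corners `𝓡∂ (m + 1)`. -/
def halfSpace (m : ℕ) : Set (Coord (m + 1)) := {y | 0 ≤ y 0}

/-! ### Riemannian geometry in coordinates

Everything in this section concerns a matrix of metric components `G` on a domain
`S ⊆ ℝ^d` (a half-space, or all of `ℝ^d`). A covariant tensor is given by its components,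
`T y a b …` being the component `T_{ab…}` at the point `y`. -/

section Coordinates

variable {d : ℕ}

/-- The partial derivative `∂_i f` at `y`, one-sided where `y` lies on the boundary of `S`. -/
def pd (S : Set (Coord d)) (i : Fin d) (f : Coord d → ℝ) (y : Coord d) : ℝ :=
  fderivWithin ℝ f S y (EuclideanSpace.single i 1)

/-- The Christoffel symbol `Γ^k_{ij}` of the Levi-Civita connection of `G`. -/
def christoffel (G : Coord d → Matrix (Fin d) (Fin d) ℝ) (S : Set (Coord d)) (y : Coord d)
    (k i j : Fin d) : ℝ :=
  (1 / 2) * ∑ l, (G y)⁻¹ k l *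
    (pd S i (fun x => G x j l) y + pd S j (fun x => G x i l) y - pd S l (fun x => G x i j) y)

/-- The coefficient of `∂_l` in `R(∂_i, ∂_j) ∂_k = (∇_i ∇_j - ∇_j ∇_i) ∂_k`. -/
def curvatureUp (G : Coord d → Matrix (Fin d) (Fin d) ℝ) (S : Set (Coord d)) (y : Coord d)
    (i j k l : Fin d) : ℝ :=
  pd S i (fun x => christoffel G S x l j k) y - pd S j (fun x => christoffel G S x l i k) y
    + ∑ p, (christoffel G S y l i p * christoffel G S y p j k
      - christoffel G S y l j p * christoffel G S y p i k)

/-- The Riemann tensor `R_{ijkl} = ⟨R(∂_i, ∂_j) ∂_k, ∂_l⟩`; `R_{ijji} > 0` on round spheres. -/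
def riem (G : Coord d → Matrix (Fin d) (Fin d) ℝ) (S : Set (Coord d)) (y : Coord d)
    (i j k l : Fin d) : ℝ :=
  ∑ p, curvatureUp G S y i j k p * G y p l

/-- The Ricci tensor `R_{jk} = g^{il} R_{ijkl}`. -/
def ricci (G : Coord d → Matrix (Fin d) (Fin d) ℝ) (S : Set (Coord d)) (y : Coord d)
    (j k : Fin d) : ℝ :=
  ∑ i, ∑ l, (G y)⁻¹ i l * riem G S y i j k l

/-- The covariant derivative `(∇_c T)_a` of a covector field. -/
def covDeriv₁ (G : Coord d → Matrix (Fin d) (Fin d) ℝ) (S : Set (Coord d))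
    (T : Coord d → Fin d → ℝ) (y : Coord d) (a c : Fin d) : ℝ :=
  pd S c (fun x => T x a) y - ∑ p, christoffel G S y p c a * T y p

/-- The covariant derivative `(∇_c T)_{ab}` of a 2-tensor. -/
def covDeriv₂ (G : Coord d → Matrix (Fin d) (Fin d) ℝ) (S : Set (Coord d))
    (T : Coord d → Fin d → Fin d → ℝ) (y : Coord d) (a b c : Fin d) : ℝ :=
  pd S c (fun x => T x a b) y
    - ∑ p, (christoffel G S y p c a * T y p b + christoffel G S y p c b * T y a p)

/-- The covariant derivative `(∇_e T)_{abc}` of a 3-tensor. -/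
def covDeriv₃ (G : Coord d → Matrix (Fin d) (Fin d) ℝ) (S : Set (Coord d))
    (T : Coord d → Fin d → Fin d → Fin d → ℝ) (y : Coord d) (a b c e : Fin d) : ℝ :=
  pd S e (fun x => T x a b c) y
    - ∑ p, (christoffel G S y p e a * T y p b c + christoffel G S y p e b * T y a p c
      + christoffel G S y p e c * T y a b p)

/-- The covariant derivative `(∇_f T)_{abce}` of a 4-tensor. -/
def covDeriv₄ (G : Coord d → Matrix (Fin d) (Fin d) ℝ) (S : Set (Coord d))
    (T : Coord d → Fin d → Fin d → Fin d → Fin d → ℝ) (y : Coord d) (a b c e f : Fin d) : ℝ :=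
  pd S f (fun x => T x a b c e) y
    - ∑ p, (christoffel G S y p f a * T y p b c e + christoffel G S y p f b * T y a p c e
      + christoffel G S y p f c * T y a b p e + christoffel G S y p f e * T y a b c p)

end Coordinates

/-! ### Geometry of the boundary `{y⁰ = 0}` of the half-space

`G` is a matrix of metric components on the half-space in `ℝ^(m+1)`. The boundary is
parametrised by `z ∈ ℝ^m`; the tangential coordinate field `∂_α` is `∂_{α.succ}`. -/

section Boundary

variable {m : ℕ}

/-- The inclusion `z ↦ (0, z)` of the boundary. -/
def incl (z : Coord m) : Coord (m + 1) :=
  WithLp.toLp 2 (Fin.cons (0 : ℝ) (fun a => z a) : Fin (m + 1) → ℝ)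

/-- The induced metric on the boundary. -/
def bdryMetric (G : Coord (m + 1) → Matrix (Fin (m + 1)) (Fin (m + 1)) ℝ) (z : Coord m) :
    Matrix (Fin m) (Fin m) ℝ :=
  Matrix.of fun α β => G (incl z) α.succ β.succ

/-- The components of the outward unit normal `ν = -∇y⁰ / |∇y⁰|` (the domain is `{y⁰ ≥ 0}`). -/
def normal (G : Coord (m + 1) → Matrix (Fin (m + 1)) (Fin (m + 1)) ℝ) (z : Coord m)
    (i : Fin (m + 1)) : ℝ :=
  -(G (incl z))⁻¹ i 0 / Real.sqrt ((G (incl z))⁻¹ 0 0)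

/-- The second fundamental form with respect to the outward unit normal,
`h_{αβ} = ⟨∇_α ν, ∂_β⟩ = -⟨∇_α ∂_β, ν⟩` (positive on the boundary of a Euclidean ball). -/
def sff (G : Coord (m + 1) → Matrix (Fin (m + 1)) (Fin (m + 1)) ℝ) (z : Coord m)
    (α β : Fin m) : ℝ :=
  -∑ i, ∑ j, christoffel G (halfSpace m) (incl z) i α.succ β.succ * G (incl z) i j * normal G z j

/-- The mean curvature `H = g^{αβ} h_{αβ}`. -/
def meanCurv (G : Coord (m + 1) → Matrix (Fin (m + 1)) (Fin (m + 1)) ℝ) (z : Coord m) : ℝ :=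
  ∑ α, ∑ β, (bdryMetric G z)⁻¹ α β * sff G z α β

/-- `|A|² = g^{αγ} g^{βδ} h_{αβ} h_{γδ}`. -/
def sffNormSq (G : Coord (m + 1) → Matrix (Fin (m + 1)) (Fin (m + 1)) ℝ) (z : Coord m) : ℝ :=
  ∑ α, ∑ β, ∑ γ, ∑ δ,
    (bdryMetric G z)⁻¹ α γ * (bdryMetric G z)⁻¹ β δ * sff G z α β * sff G z γ δ

/-- The Hessian `H_{αβ}` of the mean curvature for the Levi-Civita connection of the boundary. -/
def hessMeanCurv (G : Coord (m + 1) → Matrix (Fin (m + 1)) (Fin (m + 1)) ℝ) (z : Coord m)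
    (α β : Fin m) : ℝ :=
  covDeriv₁ (bdryMetric G) Set.univ (fun x γ => pd Set.univ γ (meanCurv G) x) z α β

/-- The boundary Laplacian `Δ h_{αβ} = g^{γδ} h_{αβ;γδ}`. -/
def lapSff (G : Coord (m + 1) → Matrix (Fin (m + 1)) (Fin (m + 1)) ℝ) (z : Coord m)
    (α β : Fin m) : ℝ :=
  ∑ γ, ∑ δ, (bdryMetric G z)⁻¹ γ δ *
    covDeriv₃ (bdryMetric G) Set.univ (covDeriv₂ (bdryMetric G) Set.univ (sff G)) z α β γ δ

/-- The tangential components `R_{αβγδ}` of the Riemann tensor of the ambient metric. -/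
def riemTan (G : Coord (m + 1) → Matrix (Fin (m + 1)) (Fin (m + 1)) ℝ) (z : Coord m)
    (α β γ δ : Fin m) : ℝ :=
  riem G (halfSpace m) (incl z) α.succ β.succ γ.succ δ.succ

/-- The component `R_{nαβn} = Rm(ν, ∂_α, ∂_β, ν)`. -/
def riemNor (G : Coord (m + 1) → Matrix (Fin (m + 1)) (Fin (m + 1)) ℝ) (z : Coord m)
    (α β : Fin m) : ℝ :=
  ∑ i, ∑ l, normal G z i * normal G z l * riem G (halfSpace m) (incl z) i α.succ β.succ l

/-- The component `R_{nαβn|n} = (∇_ν Rm)(ν, ∂_α, ∂_β, ν)`. -/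
def covRiemNor (G : Coord (m + 1) → Matrix (Fin (m + 1)) (Fin (m + 1)) ℝ) (z : Coord m)
    (α β : Fin m) : ℝ :=
  ∑ i, ∑ l, ∑ k, normal G z i * normal G z l * normal G z k *
    covDeriv₄ G (halfSpace m) (riem G (halfSpace m)) (incl z) i α.succ β.succ l k

end Boundary

/-! ### Families of metrics on a manifold with boundary -/

section Manifold

variable {m : ℕ} {M : Type*} [TopologicalSpace M] [ChartedSpace (EuclideanHalfSpace (m + 1)) M]
  [IsManifold (𝓡∂ (m + 1)) ∞ M]

/-- The components `g(∂_i, ∂_j)` of a Riemannian metric in the chart `e`, as functions on the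
half-space; the coordinate fields `∂_i` are the images of the standard basis vectors under the
differential of the inverse of the chart. -/
def metricInChart
    (g : Bundle.RiemannianMetric (TangentSpace (𝓡∂ (m + 1)) : M → Type _))
    (e : OpenPartialHomeomorph M (EuclideanHalfSpace (m + 1))) (y : Coord (m + 1)) :
    Matrix (Fin (m + 1)) (Fin (m + 1)) ℝ :=
  Matrix.of fun i j =>
    g.inner ((e.extend (𝓡∂ (m + 1))).symm y)
      (mfderivWithin 𝓘(ℝ, Coord (m + 1)) (𝓡∂ (m + 1)) (e.extend (𝓡∂ (m + 1))).symm
        (halfSpace m) y (EuclideanSpace.single i (1 : ℝ) : Coord (m + 1)))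
      (mfderivWithin 𝓘(ℝ, Coord (m + 1)) (𝓡∂ (m + 1)) (e.extend (𝓡∂ (m + 1))).symm
        (halfSpace m) y (EuclideanSpace.single j (1 : ℝ) : Coord (m + 1)))

/-- The family `g(t)`, `t ∈ J`, of Riemannian metrics is smooth, up to the boundary, in space and
time jointly: so are its components in every chart of the smooth structure. -/
def IsSmoothFamily
    (g : ℝ → Bundle.RiemannianMetric (TangentSpace (𝓡∂ (m + 1)) : M → Type _))
    (J : Set ℝ) : Prop :=
  ∀ e ∈ IsManifold.maximalAtlas (𝓡∂ (m + 1)) ∞ M, ∀ i j : Fin (m + 1),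
    ContDiffOn ℝ ∞ (fun q : ℝ × Coord (m + 1) => metricInChart (g q.1) e q.2 i j)
      (J ×ˢ (e.extend (𝓡∂ (m + 1))).target)

/-- The Ricci flow equation `∂_t g_{ij} = -2 R_{ij}` at all points of `M` and all times in `J`,
in every chart of the smooth structure. -/
def IsRicciFlow
    (g : ℝ → Bundle.RiemannianMetric (TangentSpace (𝓡∂ (m + 1)) : M → Type _))
    (J : Set ℝ) : Prop :=
  ∀ e ∈ IsManifold.maximalAtlas (𝓡∂ (m + 1)) ∞ M, ∀ t ∈ J,
    ∀ y ∈ (e.extend (𝓡∂ (m + 1))).target, ∀ i j : Fin (m + 1),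
      HasDerivWithinAt (fun s => metricInChart (g s) e y i j)
        (-2 * ricci (metricInChart (g t) e) (halfSpace m) y i j) J t

end Manifold

end BoundaryRicciFlow

end

/-!
The evolution equation is an identity between finitely many derivatives of the metric, and its
proof uses only that partial derivatives in space and time are commuting derivations. It is
therefore proved over an arbitrary commutative `ℝ`-algebra `A` with commuting derivations
(`MetricFrame`), and then applied to the ring of functions that are smooth in space and time up to
the boundary (`smoothRing`). The second fundamental form, the unit normal and the induced metric
are defined on all hypersurfaces `y⁰ = const` of the chart at once (`BoundaryFrame`), so that
every quantity lives in the same ring, and the boundary derivatives are the derivations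
`∂_1, …, ∂_m` of that ring.

Under `∂_t g = -2 Rc` the variation formula for the Levi-Civita connection (`variation_chr`,
`variation_h`) gives
`∂_t h_{αβ} = -R_{nn} h_{αβ} + ∇_α R_{βn} + ∇_β R_{αn} - ∇_n R_{αβ}`.
Splitting the traces into their normal and tangential parts (`sum_Gi_split`) and applying the
second Bianchi identity to `∇_n R_{αβ}` leaves (`evolution_h_curvature`)
`∂_t h_{αβ} = -R_{nn} h_{αβ} - R_{nαβn|n} + g^{γδ} (R_{γαnδ|β} - R_{βδnα|γ})`.
The ambient derivatives of `R_{αβnγ}` differ from its derivatives as a boundary tensor by terms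
`h * Rm`, because of the Gauss and Weingarten formulas (`drmN_eq`); there the `R_{nn}` term cancels.
By the Codazzi equation `R_{αβnγ} = h_{βγ;α} - h_{αγ;β}` the derivatives of the boundary tensor
are `Δ h_{αβ} - H_{αβ}` plus a commutator of second covariant derivatives of `h`
(`cov₃_cov₂_h_comm`). The Ricci identity and the Gauss equation express that commutator by the
tangential curvature and by cubic terms in `h` (`evolution_h_tr`).

For the application, the partial derivatives along the half-space and along the boundary are
evaluations of the derivations of the smooth ring (`realizes_of_map`), the metric is invertible in
charts because charts are diffeomorphisms (`posDef_metricInChart`), and on a time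
interval that consists of at most one point the derivative within it imposes no condition.
-/

noncomputable section

namespace BoundaryRicciFlow

/-! ### Levi-Civita calculus over a ring with commuting derivations -/

/-- A metric in a coordinate frame, in algebraic form: `A` plays the role of the ring of smooth
functions, `D i` that of the partial derivative `∂_i`, `G` is the matrix of metric components and
`Gi` its inverse. -/
structure MetricFrame (ι A : Type*) [Fintype ι] [DecidableEq ι] [CommRing A] [Algebra ℝ A] where
  /-- The partial derivatives. -/
  D : ι → Derivation ℝ A A
  comm : ∀ i j a, D i (D j a) = D j (D i a)
  /-- The metric. -/
  G : Matrix ι ι A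
  /-- The inverse metric. -/
  Gi : Matrix ι ι A
  symm : ∀ i j, G i j = G j i
  mul_inv : G * Gi = 1

/-- The entrywise derivative of a matrix. -/
def matD {ι A : Type*} [CommRing A] [Algebra ℝ A] (δ : Derivation ℝ A A) (M : Matrix ι ι A) :
    Matrix ι ι A := M.map δ

section matD

variable {ι A : Type*} [CommRing A] [Algebra ℝ A] (δ : Derivation ℝ A A) (M N : Matrix ι ι A)

@[simp] theorem matD_apply (i j : ι) : matD δ M i j = δ (M i j) := rfl

theorem matD_add : matD δ (M + N) = matD δ M + matD δ N := by ext; simp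

theorem matD_sub : matD δ (M - N) = matD δ M - matD δ N := by ext; simp

theorem matD_mul [Fintype ι] : matD δ (M * N) = matD δ M * N + M * matD δ N := by
  ext i j
  simp only [matD_apply, Matrix.mul_apply, Matrix.add_apply, map_sum, Derivation.leibniz,
    smul_eq_mul, ← Finset.sum_add_distrib]
  exact Finset.sum_congr rfl fun _ _ => by ring

theorem matD_transpose : matD δ M.transpose = (matD δ M).transpose := rfl

theorem matD_one [DecidableEq ι] : matD δ (1 : Matrix ι ι A) = 0 := by
  ext i j
  by_cases h : i = j <;> simp [h]

end matD

theorem eq_of_two_mul_eq {A : Type*} [CommRing A] [Algebra ℝ A] {a b : A}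
    (h : 2 * a = 2 * b) : a = b := by
  have := congrArg (fun x => (1 / 2 : ℝ) • x) h
  have e : ∀ x : A, (1 / 2 : ℝ) • (2 * x) = x := fun x => by
    rw [two_mul, ← two_smul ℝ x, smul_smul]; norm_num
  simpa only [e] using this

namespace MetricFrame

variable {ι A : Type*} [Fintype ι] [DecidableEq ι] [CommRing A] [Algebra ℝ A]
  (F : MetricFrame ι A)

theorem matD_comm (i j : ι) (M : Matrix ι ι A) :
    matD (F.D i) (matD (F.D j) M) = matD (F.D j) (matD (F.D i) M) := by
  ext; simp [F.comm i j]

theorem transpose_G : F.G.transpose = F.G := by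
  ext i j; exact F.symm j i

theorem inv_mul : F.Gi * F.G = 1 := mul_eq_one_comm.mp F.mul_inv

theorem transpose_Gi : F.Gi.transpose = F.Gi := by
  have h : F.Gi.transpose * F.G = 1 := by
    have := congrArg Matrix.transpose F.mul_inv
    rwa [Matrix.transpose_mul, F.transpose_G, Matrix.transpose_one] at this
  calc F.Gi.transpose = F.Gi.transpose * (F.G * F.Gi) := by rw [F.mul_inv, mul_one]
    _ = F.Gi := by rw [← mul_assoc, h, one_mul]

theorem Gi_symm (i j : ι) : F.Gi i j = F.Gi j i := congrFun (congrFun F.transpose_Gi j) i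

theorem sum_Gi_G (i k : ι) : ∑ j, F.Gi i j * F.G j k = if i = k then 1 else 0 := by
  rw [← Matrix.mul_apply, F.inv_mul, Matrix.one_apply]

theorem sum_G_Gi (i k : ι) : ∑ j, F.G i j * F.Gi j k = if i = k then 1 else 0 := by
  rw [← Matrix.mul_apply, F.mul_inv, Matrix.one_apply]

/-- Raising an index after lowering it. -/
theorem raise_lower (V : ι → A) (k : ι) : ∑ l, F.Gi k l * ∑ j, F.G l j * V j = V k := by
  simp only [Finset.mul_sum]
  rw [Finset.sum_comm]
  simp only [← mul_assoc, ← Finset.sum_mul, F.sum_Gi_G]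
  simp

/-- Lowering an index after raising it. -/
theorem lower_raise (V : ι → A) (k : ι) : ∑ l, F.G k l * ∑ j, F.Gi l j * V j = V k := by
  simp only [Finset.mul_sum]
  rw [Finset.sum_comm]
  simp only [← mul_assoc, ← Finset.sum_mul, F.sum_G_Gi]
  simp

/-- The Christoffel symbol of the first kind `⟨∇_i ∂_j, ∂_l⟩`. -/
def chrLow (i j l : ι) : A :=
  (1 / 2 : ℝ) • (F.D i (F.G j l) + F.D j (F.G i l) - F.D l (F.G i j))

/-- The Christoffel symbol `Γ^k_{ij}`. -/
def chr (k i j : ι) : A := ∑ l, F.Gi k l * F.chrLow i j l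

theorem chrLow_symm (i j l : ι) : F.chrLow i j l = F.chrLow j i l := by
  rw [chrLow, chrLow, F.symm i j, add_comm (F.D i _)]

theorem chr_symm (k i j : ι) : F.chr k i j = F.chr k j i := by
  simp only [chr, F.chrLow_symm i j]

theorem sum_G_chr (i j l : ι) : ∑ k, F.G l k * F.chr k i j = F.chrLow i j l :=
  F.lower_raise (F.chrLow i j) l

theorem sum_chr_G (i j l : ι) : ∑ k, F.chr k i j * F.G k l = F.chrLow i j l := by
  rw [← F.sum_G_chr]
  exact Finset.sum_congr rfl fun k _ => by rw [F.symm k l, mul_comm]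

theorem chrLow_add (i j l : ι) : F.chrLow i j l + F.chrLow i l j = F.D i (F.G j l) := by
  rw [chrLow, chrLow, F.symm l j]; module

/-- The connection matrix `(C_i)^k_j = Γ^k_{ij}`. -/
def conn (i : ι) : Matrix ι ι A := Matrix.of fun k j => F.chr k i j

@[simp] theorem conn_apply (i k j : ι) : F.conn i k j = F.chr k i j := rfl

/-- Compatibility of the Levi-Civita connection with the metric. -/
theorem matD_G (i : ι) :
    matD (F.D i) F.G = (F.conn i).transpose * F.G + F.G * F.conn i := by
  ext j l
  simp only [matD_apply, Matrix.add_apply, Matrix.mul_apply, Matrix.transpose_apply, conn_apply,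
    F.sum_chr_G, F.sum_G_chr, F.chrLow_add]

theorem matD_Gi (δ : Derivation ℝ A A) :
    matD δ F.Gi = -(F.Gi * matD δ F.G * F.Gi) := by
  have h := congrArg (matD δ) F.mul_inv
  rw [matD_mul, matD_one] at h
  calc matD δ F.Gi = (F.Gi * F.G) * matD δ F.Gi := by rw [F.inv_mul, one_mul]
    _ = F.Gi * (matD δ F.G * F.Gi + F.G * matD δ F.Gi) - F.Gi * matD δ F.G * F.Gi := by
        noncomm_ring
    _ = _ := by rw [h]; noncomm_ring

theorem matD_Gi_conn (i : ι) :
    matD (F.D i) F.Gi = -(F.Gi * (F.conn i).transpose) - F.conn i * F.Gi := by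
  have e : F.Gi * ((F.conn i).transpose * F.G + F.G * F.conn i) * F.Gi
      = F.Gi * (F.conn i).transpose * (F.G * F.Gi) + (F.Gi * F.G) * F.conn i * F.Gi := by
    noncomm_ring
  rw [matD_Gi, matD_G, e, F.mul_inv, F.inv_mul]
  noncomm_ring

/-- The curvature matrix `K_{ij} = ∂_i C_j - ∂_j C_i + [C_i, C_j]`. -/
def curvMat (i j : ι) : Matrix ι ι A :=
  matD (F.D i) (F.conn j) - matD (F.D j) (F.conn i) + (F.conn i * F.conn j - F.conn j * F.conn i)

/-- The coefficient of `∂_l` in `R(∂_i, ∂_j) ∂_k`. -/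
def curvUp (i j k l : ι) : A :=
  F.D i (F.chr l j k) - F.D j (F.chr l i k)
    + ∑ p, (F.chr l i p * F.chr p j k - F.chr l j p * F.chr p i k)

theorem curvMat_apply (i j k l : ι) : F.curvMat i j l k = F.curvUp i j k l := by
  simp [curvMat, curvUp, Matrix.mul_apply, Finset.sum_sub_distrib]

/-- The Riemann tensor `R_{ijkl}`. -/
def rm (i j k l : ι) : A := ∑ p, F.curvUp i j k p * F.G p l

/-- The Riemann tensor as a matrix in its last two indices. -/
def rmMat (i j : ι) : Matrix ι ι A := (F.curvMat i j).transpose * F.G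

theorem rmMat_apply (i j k l : ι) : F.rmMat i j k l = F.rm i j k l := by
  simp [rmMat, rm, Matrix.mul_apply, curvMat_apply]

/-- The Ricci tensor. -/
def ric (j k : ι) : A := ∑ i, ∑ l, F.Gi i l * F.rm i j k l

theorem curvUp_swap (i j k l : ι) : F.curvUp i j k l = -F.curvUp j i k l := by
  simp only [curvUp, Finset.sum_sub_distrib]; ring

theorem rm_swap₁₂ (i j k l : ι) : F.rm i j k l = -F.rm j i k l := by
  rw [rm, rm, ← Finset.sum_neg_distrib]
  exact Finset.sum_congr rfl fun p _ => by rw [F.curvUp_swap i j]; ring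

/-- Antisymmetry in the last two indices: the second derivatives of the metric commute. -/
theorem rmMat_transpose (i j : ι) : (F.rmMat i j).transpose = -F.rmMat i j := by
  have h := F.matD_comm i j F.G
  simp only [matD_G, matD_add, matD_mul, matD_transpose] at h
  rw [rmMat, Matrix.transpose_mul, Matrix.transpose_transpose, F.transpose_G, curvMat]
  rw [eq_neg_iff_add_eq_zero]
  simp only [Matrix.transpose_sub, Matrix.transpose_add, Matrix.transpose_mul]
  rw [← sub_eq_zero] at h
  rw [← h]
  noncomm_ring

theorem rm_swap₃₄ (i j k l : ι) : F.rm i j k l = -F.rm i j l k := by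
  have := congrFun (congrFun (F.rmMat_transpose i j) l) k
  simpa [rmMat_apply] using this

theorem curvUp_cyclic (i j k l : ι) :
    F.curvUp i j k l + F.curvUp j k i l + F.curvUp k i j l = 0 := by
  have e : ∑ p, (F.chr l i p * F.chr p j k - F.chr l j p * F.chr p i k)
      + ∑ p, (F.chr l j p * F.chr p k i - F.chr l k p * F.chr p j i)
      + ∑ p, (F.chr l k p * F.chr p i j - F.chr l i p * F.chr p k j) = 0 := by
    rw [← Finset.sum_add_distrib, ← Finset.sum_add_distrib]
    refine Finset.sum_eq_zero fun p _ => ?_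
    rw [F.chr_symm p k i, F.chr_symm p j i, F.chr_symm p k j]; ring
  simp only [curvUp]
  rw [F.chr_symm l j k, F.chr_symm l i j, F.chr_symm l i k]
  linear_combination e

/-- The first Bianchi identity. -/
theorem rm_cyclic (i j k l : ι) : F.rm i j k l + F.rm j k i l + F.rm k i j l = 0 := by
  simp only [rm]
  rw [← Finset.sum_add_distrib, ← Finset.sum_add_distrib]
  exact Finset.sum_eq_zero fun p _ => by rw [← add_mul, ← add_mul, F.curvUp_cyclic, zero_mul]

/-- The symmetry under exchange of pairs, from four instances of the first Bianchi identity. -/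
theorem rm_pair (i j k l : ι) : F.rm i j k l = F.rm k l i j := by
  apply eq_of_two_mul_eq
  linear_combination F.rm_cyclic i j k l + F.rm_cyclic j k l i - F.rm_cyclic k l i j
    - F.rm_cyclic l i j k - F.rm_swap₃₄ j k i l - F.rm_swap₃₄ k l j i + F.rm_swap₃₄ l i k j
    + F.rm_swap₃₄ i j l k - F.rm_swap₁₂ k i j l + F.rm_swap₃₄ i k j l - F.rm_swap₁₂ l j k i
    + F.rm_swap₃₄ j l k i

/-- The covariant derivative of a 2-tensor. -/
def cov₂ (T : ι → ι → A) (a b c : ι) : A :=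
  F.D c (T a b) - ∑ p, (F.chr p c a * T p b + F.chr p c b * T a p)

/-- The covariant derivative of a 3-tensor. -/
def cov₃ (T : ι → ι → ι → A) (a b c e : ι) : A :=
  F.D e (T a b c)
    - ∑ p, (F.chr p e a * T p b c + F.chr p e b * T a p c + F.chr p e c * T a b p)

/-- The covariant derivative of a 4-tensor. -/
def cov₄ (T : ι → ι → ι → ι → A) (a b c e f : ι) : A :=
  F.D f (T a b c e)
    - ∑ p, (F.chr p f a * T p b c e + F.chr p f b * T a p c e
      + F.chr p f c * T a b p e + F.chr p f e * T a b c p)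

/-- The covariant derivative of the Riemann tensor, `∇_m R_{ijkl}`. -/
def drm (i j k l m : ι) : A := F.cov₄ F.rm i j k l m

theorem drm_swap₁₂ (i j k l m : ι) : F.drm i j k l m = -F.drm j i k l m := by
  simp only [drm, cov₄, F.rm_swap₁₂ i j, map_neg]
  rw [neg_sub', ← Finset.sum_neg_distrib, sub_eq_sub_iff_sub_eq_sub, sub_self, eq_comm, sub_eq_zero]
  refine Finset.sum_congr rfl fun p _ => ?_
  rw [F.rm_swap₁₂ p j, F.rm_swap₁₂ i p]; ring

theorem drm_swap₃₄ (i j k l m : ι) : F.drm i j k l m = -F.drm i j l k m := by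
  simp only [drm, cov₄, F.rm_swap₃₄ _ _ k l, map_neg]
  rw [neg_sub', ← Finset.sum_neg_distrib, sub_eq_sub_iff_sub_eq_sub, sub_self, eq_comm, sub_eq_zero]
  refine Finset.sum_congr rfl fun p _ => ?_
  rw [F.rm_swap₃₄ _ _ p l, F.rm_swap₃₄ _ _ k p]; ring

theorem drm_pair (i j k l m : ι) : F.drm i j k l m = F.drm k l i j m := by
  simp only [drm, cov₄, F.rm_pair i j k l]
  congr 1
  refine Finset.sum_congr rfl fun p _ => ?_
  rw [F.rm_pair p j, F.rm_pair i p, F.rm_pair i j p l, F.rm_pair i j k p]; ring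

/-- The part of `∇_m R_{ijkl}` in which the connection acts on the endomorphism indices only. -/
def curvMatD (i j m : ι) : Matrix ι ι A :=
  matD (F.D m) (F.curvMat i j) + F.conn m * F.curvMat i j - F.curvMat i j * F.conn m

/-- In `∇_m R_{ijkl}` the lowered index may be raised, the metric being parallel; the terms with
`Γ_{mi}` and `Γ_{mj}` cancel in cyclic sums. -/
theorem drm_eq (i j k l m : ι) :
    F.drm i j k l m = ((F.curvMatD i j m).transpose * F.G) k l
      - ∑ p, (F.chr p m i * F.rm p j k l + F.chr p m j * F.rm i p k l) := by
  have e : (F.curvMatD i j m).transpose * F.G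
      = matD (F.D m) (F.rmMat i j) - (F.conn m).transpose * F.rmMat i j
        - F.rmMat i j * F.conn m := by
    simp only [curvMatD, rmMat, matD_mul, matD_G, matD_transpose, Matrix.transpose_sub,
      Matrix.transpose_add, Matrix.transpose_mul]
    noncomm_ring
  rw [e]
  simp only [Matrix.sub_apply, Matrix.mul_apply, Matrix.transpose_apply, conn_apply, matD_apply,
    rmMat_apply, drm, cov₄, Finset.sum_add_distrib, mul_comm (F.rm _ _ _ _)]
  ring

/-- The Jacobi identity for the operators `∂_i + C_i`. -/
theorem curvMatD_cyclic (i j m : ι) :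
    F.curvMatD i j m + F.curvMatD j m i + F.curvMatD m i j = 0 := by
  simp only [curvMatD, curvMat, matD_add, matD_sub, matD_mul]
  rw [F.matD_comm m i, F.matD_comm m j, F.matD_comm i j]
  noncomm_ring

/-- The second Bianchi identity. -/
theorem drm_cyclic (i j k l m : ι) :
    F.drm i j k l m + F.drm j m k l i + F.drm m i k l j = 0 := by
  have e := congrArg (fun M : Matrix ι ι A => (M.transpose * F.G) k l) (F.curvMatD_cyclic i j m)
  simp only [Matrix.transpose_add, add_mul, Matrix.add_apply, Matrix.transpose_zero, zero_mul,
    Matrix.zero_apply] at e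
  have s : ∑ p, (F.chr p m i * F.rm p j k l + F.chr p m j * F.rm i p k l)
      + ∑ p, (F.chr p i j * F.rm p m k l + F.chr p i m * F.rm j p k l)
      + ∑ p, (F.chr p j m * F.rm p i k l + F.chr p j i * F.rm m p k l) = 0 := by
    rw [← Finset.sum_add_distrib, ← Finset.sum_add_distrib]
    refine Finset.sum_eq_zero fun p _ => ?_
    rw [F.chr_symm p m i, F.chr_symm p m j, F.chr_symm p j i, F.rm_swap₁₂ j p, F.rm_swap₁₂ i p,
      F.rm_swap₁₂ m p]
    ring
  rw [drm_eq, drm_eq, drm_eq]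
  linear_combination e - s

/-- The covariant derivative `∇_c T` of a 2-tensor, as a matrix. -/
def covMat (c : ι) (T : Matrix ι ι A) : Matrix ι ι A :=
  matD (F.D c) T - (F.conn c).transpose * T - T * F.conn c

theorem covMat_apply (c : ι) (T : Matrix ι ι A) (a b : ι) : F.covMat c T a b = F.cov₂ T a b c := by
  simp only [covMat, cov₂, Matrix.sub_apply, Matrix.mul_apply, Matrix.transpose_apply, conn_apply,
    matD_apply, Finset.sum_add_distrib, mul_comm (T _ _)]
  ring

theorem covMat_comm (c e : ι) (T : Matrix ι ι A) :
    F.covMat e (F.covMat c T) - F.covMat c (F.covMat e T)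
      = -((F.curvMat e c).transpose * T) - T * F.curvMat e c := by
  simp only [covMat, curvMat, matD_sub, matD_mul, matD_transpose, F.matD_comm e c,
    Matrix.transpose_sub, Matrix.transpose_add, Matrix.transpose_mul]
  noncomm_ring

/-- The Ricci identity for the second covariant derivatives of a 2-tensor. -/
theorem cov₃_cov₂_comm (T : ι → ι → A) (a b c e : ι) :
    F.cov₃ (F.cov₂ T) a b c e - F.cov₃ (F.cov₂ T) a b e c
      = -∑ p, (F.curvUp e c a p * T p b + F.curvUp e c b p * T a p) := by
  have key : ∀ c e : ι, F.cov₃ (F.cov₂ T) a b c e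
      = F.covMat e (F.covMat c (Matrix.of T)) a b - ∑ p, F.chr p e c * F.cov₂ T a b p := by
    intro c e
    rw [covMat_apply]
    simp only [cov₃, cov₂, covMat_apply, Finset.sum_add_distrib, Matrix.of_apply]
    ring
  have h := congrFun (congrFun (F.covMat_comm c e (Matrix.of T)) a) b
  simp only [Matrix.sub_apply, Matrix.neg_apply, Matrix.mul_apply, Matrix.transpose_apply,
    curvMat_apply, Matrix.of_apply] at h
  rw [key, key, Finset.sum_add_distrib]
  simp only [F.chr_symm _ e c]
  simp only [mul_comm (T _ _)] at h
  linear_combination h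

/-- Contraction with the inverse metric commutes with covariant differentiation. -/
theorem D_trace (T : ι → ι → A) (c : ι) :
    F.D c (∑ a, ∑ b, F.Gi a b * T a b) = ∑ a, ∑ b, F.Gi a b * F.cov₂ T a b c := by
  have tr : ∀ S : Matrix ι ι A, ∑ a, ∑ b, F.Gi a b * S a b = (F.Gi * S.transpose).trace := by
    intro S; simp [Matrix.trace, Matrix.mul_apply]
  have trD : ∀ S : Matrix ι ι A, F.D c S.trace = (matD (F.D c) S).trace := by
    intro S; simp [Matrix.trace]
  have h1 := tr (Matrix.of T)
  have h2 := tr (F.covMat c (Matrix.of T))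
  simp only [covMat_apply, Matrix.of_apply] at h1 h2
  rw [h1, trD]
  refine Eq.trans ?_ h2.symm
  simp only [matD_mul, matD_Gi_conn, covMat, Matrix.transpose_sub, Matrix.transpose_mul,
    Matrix.transpose_transpose, matD_transpose]
  have c1 := Matrix.trace_mul_comm (F.conn c) (F.Gi * (Matrix.of T).transpose)
  simp only [sub_mul, mul_sub, neg_mul, Matrix.trace_add, Matrix.trace_sub, Matrix.trace_neg,
    ← mul_assoc] at c1 ⊢
  linear_combination -c1

/-- The covariant derivative of a trace of a 3-tensor over its first two indices. -/
theorem trace_cov₃ (T : ι → ι → ι → A) (c e : ι) :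
    ∑ a, ∑ b, F.Gi a b * F.cov₃ T a b c e
      = F.D e (∑ a, ∑ b, F.Gi a b * T a b c)
        - ∑ p, F.chr p e c * ∑ a, ∑ b, F.Gi a b * T a b p := by
  rw [F.D_trace (fun a b => T a b c)]
  have : ∀ a b, F.cov₃ T a b c e
      = F.cov₂ (fun a b => T a b c) a b e - ∑ p, F.chr p e c * T a b p := by
    intro a b
    simp only [cov₃, cov₂, Finset.sum_add_distrib]; ring
  simp only [this, mul_sub, Finset.sum_sub_distrib]
  congr 1
  simp only [Finset.mul_sum]
  conv_rhs => rw [Finset.sum_comm]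
  refine Finset.sum_congr rfl fun a _ => ?_
  rw [Finset.sum_comm]
  exact Finset.sum_congr rfl fun p _ => Finset.sum_congr rfl fun b _ => by ring

/-- The covariant derivative of the Ricci tensor is the trace of that of the Riemann tensor. -/
theorem cov₂_ric (j k m : ι) :
    F.cov₂ F.ric j k m = ∑ i, ∑ l, F.Gi i l * F.drm i j k l m := by
  have h := F.D_trace (fun i l => F.rm i j k l) m
  have e : ∀ i l, F.drm i j k l m = F.cov₂ (fun i l => F.rm i j k l) i l m
      - ∑ p, (F.chr p m j * F.rm i p k l + F.chr p m k * F.rm i j p l) := by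
    intro i l
    simp only [drm, cov₄, cov₂, Finset.sum_add_distrib]; ring
  simp only [e, mul_sub, Finset.sum_sub_distrib, ← h]
  rw [cov₂]
  congr 1
  simp only [ric, Finset.mul_sum, ← Finset.sum_add_distrib]
  rw [Finset.sum_comm]
  refine Finset.sum_congr rfl fun a _ => ?_
  rw [Finset.sum_comm]
  exact Finset.sum_congr rfl fun p _ => Finset.sum_congr rfl fun b _ => by ring

/-! ### Lowered curvature, traces, and the variation of the connection -/

/-- The lowered Riemann tensor in terms of the Christoffel symbols of the first kind. The
upper index `p` of `∇_j ∂_k` is contracted with the covector `⟨∇_i ∂_l, ∂_p⟩`, a form to which the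
Gauss formula applies directly. -/
theorem rm_eq_chrLow (i j k l : ι) :
    F.rm i j k l = F.D i (F.chrLow j k l) - F.D j (F.chrLow i k l)
      - ∑ p, F.chr p j k * F.chrLow i l p + ∑ p, F.chr p i k * F.chrLow j l p := by
  -- Lowering `∂_i Γ_{jk} + Γ_i Γ_{jk}` and moving the derivative of the metric to the right.
  have e : ∀ i j, ∑ p, (F.D i (F.chr p j k) + ∑ q, F.chr p i q * F.chr q j k) * F.G p l
      = F.D i (F.chrLow j k l) - ∑ p, F.chr p j k * F.chrLow i l p := by
    intro i j
    rw [← F.sum_chr_G j k l, map_sum]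
    simp only [Derivation.leibniz, smul_eq_mul, add_mul, Finset.sum_add_distrib, Finset.sum_mul,
      ← F.chrLow_add i _ l]
    rw [Finset.sum_comm (f := fun x y => F.chr x i y * F.chr y j k * F.G x l)]
    have : ∀ q, ∑ p, F.chr p i q * F.chr q j k * F.G p l = F.chr q j k * F.chrLow i q l := by
      intro q
      rw [← F.sum_chr_G, Finset.mul_sum]
      exact Finset.sum_congr rfl fun p _ => by ring
    simp only [this, mul_add, Finset.sum_add_distrib, mul_comm (F.G _ _)]
    ring
  have h : F.rm i j k l
      = ∑ p, (F.D i (F.chr p j k) + ∑ q, F.chr p i q * F.chr q j k) * F.G p l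
        - ∑ p, (F.D j (F.chr p i k) + ∑ q, F.chr p j q * F.chr q i k) * F.G p l := by
    rw [rm, ← Finset.sum_sub_distrib]
    refine Finset.sum_congr rfl fun p _ => ?_
    rw [curvUp, Finset.sum_sub_distrib]; ring
  rw [h, e, e]; ring

theorem curvUp_eq_sum_rm (i j k p : ι) :
    F.curvUp i j k p = ∑ l, F.Gi p l * F.rm i j k l := by
  rw [← F.raise_lower (F.curvUp i j k) p]
  refine Finset.sum_congr rfl fun l _ => ?_
  rw [rm]
  congr 1
  exact Finset.sum_congr rfl fun q _ => by rw [F.symm l q, mul_comm]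

/-- The trace `g^{ab} T_{ab}`. -/
def tr (T : ι → ι → A) : A := ∑ a, ∑ b, F.Gi a b * T a b

theorem tr_add (T U : ι → ι → A) : F.tr (fun a b => T a b + U a b) = F.tr T + F.tr U := by
  simp [tr, mul_add, Finset.sum_add_distrib]

theorem tr_sub (T U : ι → ι → A) : F.tr (fun a b => T a b - U a b) = F.tr T - F.tr U := by
  simp [tr, mul_sub, Finset.sum_sub_distrib]

theorem tr_neg (T : ι → ι → A) : F.tr (fun a b => -T a b) = -F.tr T := by
  simp [tr]

theorem tr_mul_left (c : A) (T : ι → ι → A) : F.tr (fun a b => c * T a b) = c * F.tr T := by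
  simp only [tr, Finset.mul_sum]
  exact Finset.sum_congr rfl fun _ _ => Finset.sum_congr rfl fun _ _ => by ring

theorem tr_mul_right (c : A) (T : ι → ι → A) : F.tr (fun a b => T a b * c) = F.tr T * c := by
  simp only [mul_comm _ c, tr_mul_left]

theorem tr_swap (T : ι → ι → A) : F.tr (fun a b => T b a) = F.tr T := by
  rw [tr, Finset.sum_comm]
  exact Finset.sum_congr rfl fun a _ => Finset.sum_congr rfl fun b _ => by rw [F.Gi_symm]

theorem cov₂_symm {T : ι → ι → A} (hT : ∀ a b, T a b = T b a) (a b c : ι) :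
    F.cov₂ T a b c = F.cov₂ T b a c := by
  simp only [cov₂, hT a b]
  congr 1
  exact Finset.sum_congr rfl fun p _ => by rw [hT p b, hT a p]; ring

theorem cov₃_symm {T : ι → ι → ι → A} (hT : ∀ a b c, T a b c = T b a c) (a b c e : ι) :
    F.cov₃ T a b c e = F.cov₃ T b a c e := by
  simp only [cov₃, hT a b]
  congr 1
  exact Finset.sum_congr rfl fun p _ => by rw [hT p b, hT a p]; ring

/-- First variation of the Levi-Civita connection: if `δ g = V`, then
`2 ⟨δ ∇_i ∂_j, ∂_l⟩ = ∇_i V_{jl} + ∇_j V_{il} - ∇_l V_{ij}`. -/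
theorem variation_chr (δ : Derivation ℝ A A) (hδ : ∀ i a, δ (F.D i a) = F.D i (δ a))
    (V : ι → ι → A) (hV : ∀ i j, δ (F.G i j) = V i j) (i j l : ι) :
    2 * ∑ k, F.G l k * δ (F.chr k i j) = F.cov₂ V j l i + F.cov₂ V i l j - F.cov₂ V i j l := by
  have hs : ∀ i j, V i j = V j i := fun i j => by rw [← hV, ← hV, F.symm]
  -- Differentiate `⟨∇_i ∂_j, ∂_l⟩` in terms of `Γ` and in terms of the derivatives of `g`.
  have h1 := congrArg δ (F.sum_G_chr i j l)
  rw [map_sum] at h1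
  simp only [Derivation.leibniz, smul_eq_mul, Finset.sum_add_distrib, hV, chrLow,
    Derivation.map_smul, map_add, map_sub, hδ] at h1
  have h2 : 2 * ((1 / 2 : ℝ) • (F.D i (V j l) + F.D j (V i l) - F.D l (V i j)))
      = F.D i (V j l) + F.D j (V i l) - F.D l (V i j) := by
    rw [two_mul, ← two_smul ℝ, smul_smul]; norm_num
  have h3 : F.cov₂ V j l i + F.cov₂ V i l j - F.cov₂ V i j l
      = F.D i (V j l) + F.D j (V i l) - F.D l (V i j) - 2 * ∑ p, F.chr p i j * V l p := by
    have : ∑ p, (F.chr p i j * V p l + F.chr p i l * V j p)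
        + ∑ p, (F.chr p j i * V p l + F.chr p j l * V i p)
        - ∑ p, (F.chr p l i * V p j + F.chr p l j * V i p) = 2 * ∑ p, F.chr p i j * V l p := by
      rw [← Finset.sum_add_distrib, ← Finset.sum_sub_distrib, Finset.mul_sum]
      refine Finset.sum_congr rfl fun p _ => ?_
      rw [F.chr_symm p j i, F.chr_symm p l i, F.chr_symm p l j, hs p l, hs p j]; ring
    simp only [cov₂]
    linear_combination -this
  rw [h3]
  linear_combination 2 * h1 + h2

end MetricFrame

/-! ### The hypersurfaces `y⁰ = const` -/

/-- A metric in a coordinate frame `∂_0, …, ∂_m`, together with the data of the hypersurfaces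
`y⁰ = const`: the factor `N = (g^{00})^{-1/2}` and the inverse `b` of the induced metric. -/
structure BoundaryFrame (m : ℕ) (A : Type*) [CommRing A] [Algebra ℝ A] extends
    MetricFrame (Fin (m + 1)) A where
  /-- The factor `(g^{00})^{-1/2}`, so that `ν_i = -N δ_i^0`. -/
  N : A
  N_sq : N * N * Gi 0 0 = 1
  /-- The inverse of the induced metric. -/
  b : Matrix (Fin m) (Fin m) A
  mul_b : (Matrix.of fun α β : Fin m => G α.succ β.succ) * b = 1

namespace BoundaryFrame

variable {m : ℕ} {A : Type*} [CommRing A] [Algebra ℝ A] (F : BoundaryFrame m A)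

/-- The induced metric of the hypersurfaces `y⁰ = const`. -/
def slice : MetricFrame (Fin m) A where
  D α := F.D α.succ
  comm _ _ := F.comm _ _
  G := Matrix.of fun α β => F.G α.succ β.succ
  Gi := F.b
  symm _ _ := F.symm _ _
  mul_inv := F.mul_b

/-- The unit normal `ν` of the hypersurfaces `y⁰ = const`. -/
def nu (i : Fin (m + 1)) : A := -(F.Gi i 0 * F.N)

/-- Contraction of an index with the unit normal. -/
def con (f : Fin (m + 1) → A) : A := ∑ i, F.nu i * f i

theorem con_add (f g : Fin (m + 1) → A) : F.con (fun i => f i + g i) = F.con f + F.con g := by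
  simp [con, mul_add, Finset.sum_add_distrib]

theorem con_sub (f g : Fin (m + 1) → A) : F.con (fun i => f i - g i) = F.con f - F.con g := by
  simp [con, mul_sub, Finset.sum_sub_distrib]

theorem con_neg (f : Fin (m + 1) → A) : F.con (fun i => -f i) = -F.con f := by
  simp [con]

theorem con_mul_left (c : A) (f : Fin (m + 1) → A) :
    F.con (fun i => c * f i) = c * F.con f := by
  simp only [con, Finset.mul_sum]
  exact Finset.sum_congr rfl fun _ _ => by ring

theorem con_sum {κ : Type*} (s : Finset κ) (f : κ → Fin (m + 1) → A) :
    F.con (fun i => ∑ k ∈ s, f k i) = ∑ k ∈ s, F.con (f k) := by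
  simp only [con, Finset.mul_sum]
  exact Finset.sum_comm

theorem con_comm (f : Fin (m + 1) → Fin (m + 1) → A) :
    F.con (fun i => F.con fun j => f i j) = F.con fun j => F.con fun i => f i j := by
  simp only [con, Finset.mul_sum]
  rw [Finset.sum_comm]
  exact Finset.sum_congr rfl fun _ _ => Finset.sum_congr rfl fun _ _ => by ring

theorem con_tr (f : Fin (m + 1) → Fin m → Fin m → A) :
    F.con (fun i => F.slice.tr (f i)) = F.slice.tr fun γ δ => F.con fun i => f i γ δ := by
  simp only [MetricFrame.tr, con_sum, con_mul_left]

theorem con_con_of_antisymm {f : Fin (m + 1) → Fin (m + 1) → A}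
    (h : ∀ i j, f i j = -f j i) : F.con (fun i => F.con fun j => f i j) = 0 := by
  apply eq_of_two_mul_eq
  rw [mul_zero, two_mul]
  nth_rewrite 2 [con_comm]
  rw [← con_add]
  simp only [← con_add]
  simp only [con]
  refine Finset.sum_eq_zero fun i _ => ?_
  rw [Finset.sum_eq_zero, mul_zero]
  intro j _
  rw [h i j]; ring

theorem Gi_zero (j : Fin (m + 1)) : F.Gi 0 j = F.nu 0 * F.nu j := by
  rw [nu, nu, F.Gi_symm 0 j]
  linear_combination -(F.Gi j 0) * F.N_sq

/-- The inverse of the induced metric is the Schur complement of `g^{00}` in `g^{ij}`. -/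
theorem Gi_succ_succ (α β : Fin m) :
    F.Gi α.succ β.succ = F.nu α.succ * F.nu β.succ + F.b α β := by
  have h1 : (Matrix.of fun α β : Fin m => F.G α.succ β.succ)
      * (Matrix.of fun α β : Fin m => F.Gi α.succ β.succ - F.nu α.succ * F.nu β.succ) = 1 := by
    ext γ β
    have e1 := F.sum_G_Gi γ.succ β.succ
    have e2 := F.sum_G_Gi γ.succ 0
    rw [Fin.sum_univ_succ] at e1 e2
    simp only [Fin.succ_ne_zero, if_false, Fin.succ_inj] at e1 e2
    simp only [Matrix.mul_apply, Matrix.of_apply, mul_sub, Finset.sum_sub_distrib,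
      Matrix.one_apply, nu]
    have e3 : ∑ x : Fin m, F.G γ.succ x.succ * (-(F.Gi x.succ 0 * F.N) * -(F.Gi β.succ 0 * F.N))
        = (∑ x : Fin m, F.G γ.succ x.succ * F.Gi x.succ 0) * (F.N * F.N * F.Gi β.succ 0) := by
      rw [Finset.sum_mul]
      exact Finset.sum_congr rfl fun _ _ => by ring
    rw [e3, ← e1]
    have e4 := F.Gi_symm 0 β.succ
    linear_combination (-F.N * F.N * F.Gi β.succ 0) * e2
      + F.G γ.succ 0 * F.Gi β.succ 0 * F.N_sq - F.G γ.succ 0 * e4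
  have h2 := congrArg (F.b * ·) h1
  simp only [← mul_assoc, mul_one] at h2
  rw [mul_eq_one_comm.mp F.mul_b, one_mul] at h2
  have := congrFun (congrFun h2 α) β
  simp only [Matrix.of_apply] at this
  rw [← this]; ring

/-- The ambient trace splits into its normal and its tangential part. -/
theorem sum_Gi_split (f : Fin (m + 1) → Fin (m + 1) → A) :
    ∑ i, ∑ j, F.Gi i j * f i j
      = F.con (fun i => F.con fun j => f i j) + F.slice.tr fun γ δ => f γ.succ δ.succ := by
  simp only [con, MetricFrame.tr, slice, Finset.mul_sum]
  simp only [Fin.sum_univ_succ, F.Gi_succ_succ, F.Gi_zero, F.Gi_symm _ 0, add_mul,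
    Finset.sum_add_distrib]
  simp only [← mul_assoc, mul_comm (F.nu 0) (F.nu _)]
  ring

theorem sum_G_nu (i : Fin (m + 1)) : ∑ j, F.G i j * F.nu j = if i = 0 then -F.N else 0 := by
  have : ∑ j, F.G i j * F.nu j = -(∑ j, F.G i j * F.Gi j 0) * F.N := by
    rw [← Finset.sum_neg_distrib, Finset.sum_mul]
    exact Finset.sum_congr rfl fun _ _ => by rw [nu]; ring
  rw [this, F.sum_G_Gi]
  split_ifs <;> ring

/-- The second fundamental form `-⟨∇_α ∂_β, ν⟩`. -/
def h (α β : Fin m) : A := -∑ i, ∑ j, F.chr i α.succ β.succ * F.G i j * F.nu j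

theorem sum_sum_G_nu (V : Fin (m + 1) → A) :
    ∑ i, ∑ j, V i * F.G i j * F.nu j = -(V 0 * F.N) := by
  simp only [mul_assoc, ← Finset.mul_sum, F.sum_G_nu]
  simp

theorem h_eq_chr (α β : Fin m) : F.h α β = F.N * F.chr 0 α.succ β.succ := by
  rw [h, F.sum_sum_G_nu (fun i => F.chr i α.succ β.succ)]; ring

theorem h_symm (α β : Fin m) : F.h α β = F.h β α := by
  rw [h_eq_chr, h_eq_chr, F.chr_symm]

theorem h_eq_con (α β : Fin m) : F.h α β = -F.con (F.chrLow α.succ β.succ) := by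
  rw [h_eq_chr, MetricFrame.chr, con, Finset.mul_sum, ← Finset.sum_neg_distrib]
  exact Finset.sum_congr rfl fun l _ => by rw [nu, F.Gi_symm 0 l]; ring

theorem slice_chrLow (α β γ : Fin m) :
    F.slice.chrLow α β γ = F.chrLow α.succ β.succ γ.succ := rfl

/-- The Gauss formula `∇_μ ∂_α = Γ̄^ρ_{μα} ∂_ρ - h_{μα} ν`, contracted with a covector. -/
theorem gauss_formula (μ α : Fin m) (f : Fin (m + 1) → A) :
    ∑ p, F.chr p μ.succ α.succ * f p
      = ∑ ρ, F.slice.chr ρ μ α * f ρ.succ - F.h μ α * F.con f := by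
  have e1 : ∑ p, F.chr p μ.succ α.succ * f p
      = ∑ p, ∑ l, F.Gi p l * (F.chrLow μ.succ α.succ l * f p) := by
    simp only [MetricFrame.chr, Finset.sum_mul, mul_assoc]
  have e2 : ∑ ρ, F.slice.chr ρ μ α * f ρ.succ
      = F.slice.tr fun ρ σ => F.chrLow μ.succ α.succ σ.succ * f ρ.succ := by
    simp only [MetricFrame.chr, Finset.sum_mul, mul_assoc, MetricFrame.tr, slice_chrLow]
  have e3 : F.con (fun p => F.con fun l => F.chrLow μ.succ α.succ l * f p)
      = -(F.h μ α * F.con f) := by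
    simp only [mul_comm _ (f _), con_mul_left]
    simp only [mul_comm (f _), con_mul_left, h_eq_con, neg_mul, neg_neg]
  rw [e1, sum_Gi_split, e2, e3]; ring

/-- The derivative `∇_μ ν` of the unit normal. -/
def dnu (μ : Fin m) (k : Fin (m + 1)) : A :=
  F.D μ.succ (F.nu k) + ∑ p, F.chr k μ.succ p * F.nu p

/-- Lowering the index of `∇_μ ν` by the compatibility of the connection with the metric. -/
theorem sum_G_dnu (μ : Fin m) (l : Fin (m + 1)) :
    ∑ k, F.G l k * F.dnu μ k
      = F.D μ.succ (∑ k, F.G l k * F.nu k) - ∑ p, F.chr p μ.succ l * ∑ k, F.G p k * F.nu k := by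
  rw [map_sum]
  simp only [Derivation.leibniz, smul_eq_mul, dnu, mul_add, Finset.sum_add_distrib,
    ← F.chrLow_add μ.succ]
  have e1 : ∑ k, F.G l k * ∑ p, F.chr k μ.succ p * F.nu p
      = ∑ p, F.nu p * F.chrLow μ.succ p l := by
    simp only [← F.sum_G_chr, Finset.mul_sum]
    rw [Finset.sum_comm]
    exact Finset.sum_congr rfl fun _ _ => Finset.sum_congr rfl fun _ _ => by ring
  have e2 : ∑ p, F.chr p μ.succ l * ∑ k, F.G p k * F.nu k
      = ∑ p, F.nu p * F.chrLow μ.succ l p := by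
    simp only [← F.sum_chr_G, Finset.mul_sum]
    rw [Finset.sum_comm]
    exact Finset.sum_congr rfl fun _ _ => Finset.sum_congr rfl fun _ _ => by ring
  rw [e1, e2]; ring

/-- The derivative of the unit normal is tangential: `⟨∇_μ ν, ν⟩ = 0`. -/
theorem con_sum_G_dnu (μ : Fin m) : F.con (fun l => ∑ k, F.G l k * F.dnu μ k) = 0 := by
  -- With `Y = N Γ^0_{μp} ν^p`, lowering the index of `∇_μ ν` or not gives the two values
  -- `-ν^0 ∂_μ N + Y` and `-N ∂_μ ν^0 - Y` for `⟨∇_μ ν, ν⟩`; they add up to `∂_μ (N² g^{00}) = 0`.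
  have e0 := congrArg (F.D μ.succ) F.N_sq
  simp only [Derivation.leibniz, smul_eq_mul, Derivation.map_one_eq_zero] at e0
  have e1 : F.con (fun l => ∑ k, F.G l k * F.dnu μ k) = -F.N * F.dnu μ 0 := by
    have : F.con (fun l => ∑ k, F.G l k * F.dnu μ k)
        = ∑ k, ∑ l, F.dnu μ k * F.G k l * F.nu l := by
      simp only [con, Finset.mul_sum]
      rw [Finset.sum_comm]
      refine Finset.sum_congr rfl fun k _ => Finset.sum_congr rfl fun l _ => ?_
      rw [F.symm l k]; ring
    rw [this, sum_sum_G_nu]; ring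
  have e2 : F.con (fun l => ∑ k, F.G l k * F.dnu μ k)
      = -F.nu 0 * F.D μ.succ F.N + F.N * ∑ p, F.chr 0 μ.succ p * F.nu p := by
    simp only [F.sum_G_dnu, F.sum_G_nu]
    rw [con, Fin.sum_univ_succ]
    simp only [if_true, Fin.succ_ne_zero, if_false, map_zero, map_neg, mul_ite, mul_zero,
      Finset.sum_ite_eq', Finset.mem_univ]
    rw [Fin.sum_univ_succ (fun p => F.chr 0 μ.succ p * F.nu p), mul_add, Finset.mul_sum]
    have : ∀ x : Fin m, F.nu x.succ * (0 - F.chr 0 μ.succ x.succ * -F.N)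
        = F.N * (F.chr 0 μ.succ x.succ * F.nu x.succ) := fun x => by ring
    simp only [this]; ring
  apply eq_of_two_mul_eq
  rw [mul_zero, two_mul]
  nth_rewrite 1 [e1]
  rw [e2, dnu, nu, map_neg, Derivation.leibniz, smul_eq_mul, smul_eq_mul]
  linear_combination e0

/-- The Weingarten formula `∇_μ ν = h_μ^ρ ∂_ρ`, contracted with a covector. -/
theorem weingarten (μ : Fin m) (f : Fin (m + 1) → A) :
    ∑ k, F.dnu μ k * f k = F.slice.tr fun ρ σ => F.h μ σ * f ρ.succ := by
  have e1 : ∑ k, F.dnu μ k * f k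
      = ∑ k, ∑ l, F.Gi k l * ((∑ j, F.G l j * F.dnu μ j) * f k) := by
    refine Finset.sum_congr rfl fun k _ => ?_
    simp only [← mul_assoc, ← Finset.sum_mul]
    rw [F.raise_lower (F.dnu μ) k]
  have e2 : ∀ γ : Fin m, ∑ j, F.G γ.succ j * F.dnu μ j = F.h μ γ := by
    intro γ
    rw [F.sum_G_dnu, h_eq_chr]
    simp only [F.sum_G_nu, Fin.succ_ne_zero, if_false, map_zero, mul_ite, mul_zero,
      Finset.sum_ite_eq', Finset.mem_univ, if_true]
    ring
  rw [e1, sum_Gi_split]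
  simp only [mul_comm _ (f _), con_mul_left, con_sum_G_dnu, mul_zero, e2]
  simp [con]

/-- The Gauss equation. -/
theorem gauss (α β γ δ : Fin m) :
    F.rm α.succ β.succ γ.succ δ.succ
      = F.slice.rm α β γ δ - F.h β γ * F.h α δ + F.h α γ * F.h β δ := by
  rw [F.rm_eq_chrLow, F.slice.rm_eq_chrLow, gauss_formula, gauss_formula, F.h_eq_con α δ,
    F.h_eq_con β δ]
  simp only [slice_chrLow]
  simp only [slice]
  ring

/-- The component `R_{αβnγ}`. -/
def rmN (α β γ : Fin m) : A := F.con fun k => F.rm α.succ β.succ k γ.succ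

/-- The Codazzi equation `R_{αβnγ} = h_{βγ;α} - h_{αγ;β}`. -/
theorem codazzi (α β γ : Fin m) :
    F.rmN α β γ = F.slice.cov₂ F.h β γ α - F.slice.cov₂ F.h α γ β := by
  have e1 : F.rmN α β γ = F.N * F.curvUp α.succ β.succ γ.succ 0 := by
    have : F.rmN α β γ
        = -∑ p, ∑ k, F.curvUp α.succ β.succ γ.succ p * F.G p k * F.nu k := by
      simp only [rmN, con, F.rm_swap₃₄ _ _ _ γ.succ]
      simp only [MetricFrame.rm, mul_neg, Finset.sum_neg_distrib, Finset.mul_sum]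
      rw [Finset.sum_comm]
      congr 1
      exact Finset.sum_congr rfl fun _ _ => Finset.sum_congr rfl fun _ _ => by ring
    rw [this, sum_sum_G_nu]; ring
  -- `∂_μ N` is governed by `⟨∇_μ ν, ν⟩ = 0`.
  have e2 : ∀ μ β γ : Fin m, F.N * F.D μ.succ (F.chr 0 β.succ γ.succ)
      = F.D μ.succ (F.h β γ) + F.h β γ * (F.N * F.con (F.chr 0 μ.succ)) := by
    intro μ β γ
    have a1 : F.D μ.succ (F.h β γ) = F.N * F.D μ.succ (F.chr 0 β.succ γ.succ)
        + F.chr 0 β.succ γ.succ * F.D μ.succ F.N := by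
      rw [h_eq_chr, Derivation.leibniz, smul_eq_mul, smul_eq_mul]
    have a2 : -F.N * F.dnu μ 0 = 0 := by
      rw [← F.con_sum_G_dnu μ]
      have := F.sum_sum_G_nu (F.dnu μ)
      rw [neg_mul, mul_comm, ← this, con]
      simp only [Finset.mul_sum]
      rw [Finset.sum_comm]
      refine Finset.sum_congr rfl fun k _ => Finset.sum_congr rfl fun l _ => ?_
      rw [F.symm k l]; ring
    have a3 : F.con (F.chr 0 μ.succ) = ∑ p, F.chr 0 μ.succ p * F.nu p := by
      simp only [con, mul_comm]
    have a4 := congrArg (F.D μ.succ) F.N_sq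
    simp only [Derivation.leibniz, smul_eq_mul, Derivation.map_one_eq_zero] at a4
    rw [dnu, ← a3, nu, map_neg, Derivation.leibniz, smul_eq_mul, smul_eq_mul] at a2
    rw [a1, h_eq_chr]
    set c := F.chr 0 β.succ γ.succ
    linear_combination c * F.N * (a2 - a4) + c * F.D μ.succ F.N * F.N_sq
  have e3 : ∀ μ β γ : Fin m, F.N * ∑ p, F.chr 0 μ.succ p * F.chr p β.succ γ.succ
      = ∑ ρ, F.slice.chr ρ β γ * F.h μ ρ - F.h β γ * (F.N * F.con (F.chr 0 μ.succ)) := by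
    intro μ β γ
    simp only [mul_comm (F.chr 0 μ.succ _), gauss_formula, h_eq_chr, mul_sub, Finset.mul_sum]
    congr 1
    · exact Finset.sum_congr rfl fun _ _ => by ring
    · ring
  rw [e1, MetricFrame.curvUp, Finset.sum_sub_distrib]
  simp only [mul_add, mul_sub, e2, e3]
  simp only [MetricFrame.cov₂, Finset.sum_add_distrib, F.slice.chr_symm _ β α]
  simp only [F.h_symm α, F.h_symm β]
  simp only [slice]
  ring

/-- The component `R_{nαβn}`. -/
def rmNN (α β : Fin m) : A := F.con fun i => F.con fun l => F.rm i α.succ β.succ l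

theorem rmNN_symm (α β : Fin m) : F.rmNN α β = F.rmNN β α := by
  rw [rmNN, con_comm, rmNN]
  congr 1; ext i; congr 1; ext l
  rw [F.rm_pair, F.rm_swap₁₂, F.rm_swap₃₄, neg_neg]

/-- The component `R_{αβnγ|μ}`. -/
def drmN (α β γ μ : Fin m) : A := F.con fun k => F.drm α.succ β.succ k γ.succ μ.succ

/-- The Leibniz rule for the contraction of a covector field with the normal; the derivative of
the normal is given by the Weingarten formula. -/
theorem D_con (μ : Fin m) (f : Fin (m + 1) → A) :
    F.con (fun k => F.D μ.succ (f k) - ∑ p, F.chr p μ.succ k * f p)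
      = F.D μ.succ (F.con f) - F.slice.tr fun ρ σ => F.h μ σ * f ρ.succ := by
  rw [← weingarten]
  simp only [con, map_sum, Derivation.leibniz, smul_eq_mul, mul_sub, Finset.sum_sub_distrib, dnu,
    add_mul, Finset.sum_add_distrib, Finset.mul_sum, Finset.sum_mul]
  rw [Finset.sum_comm (f := fun k p => F.nu k * (F.chr p μ.succ k * f p))]
  have : ∀ p k, F.nu k * (F.chr p μ.succ k * f p) = F.chr p μ.succ k * F.nu k * f p :=
    fun p k => by ring
  simp only [this, mul_comm (f _)]
  ring

/-- The derivative `R_{αβnγ|μ}` of the curvature against the derivative `R_{αβnγ;μ}` of the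
boundary tensor `R_{αβnγ}`: the difference comes from the Gauss and Weingarten formulas. -/
theorem drmN_eq (α β γ μ : Fin m) :
    F.drmN α β γ μ = F.slice.cov₃ F.rmN α β γ μ - F.h μ α * F.rmNN β γ + F.h μ β * F.rmNN α γ
      - F.slice.tr fun ρ σ => F.h μ σ * F.rm α.succ β.succ ρ.succ γ.succ := by
  have e : ∀ k, F.drm α.succ β.succ k γ.succ μ.succ
      = (F.D μ.succ (F.rm α.succ β.succ k γ.succ)
          - ∑ p, F.chr p μ.succ k * F.rm α.succ β.succ p γ.succ)
        - ∑ p, F.chr p μ.succ α.succ * F.rm p β.succ k γ.succ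
        - ∑ p, F.chr p μ.succ β.succ * F.rm α.succ p k γ.succ
        - ∑ p, F.chr p μ.succ γ.succ * F.rm α.succ β.succ k p := by
    intro k
    simp only [MetricFrame.drm, MetricFrame.cov₄, Finset.sum_add_distrib]; ring
  have n1 : F.con (fun p => F.con fun k => F.rm p β.succ k γ.succ) = -F.rmNN β γ := by
    rw [rmNN, ← con_neg]
    congr 1; ext p; rw [← con_neg]; congr 1; ext k; rw [F.rm_swap₃₄]
  have n2 : F.con (fun p => F.con fun k => F.rm α.succ p k γ.succ) = F.rmNN α γ := by
    rw [rmNN]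
    congr 1; ext p; congr 1; ext k; rw [F.rm_swap₃₄, F.rm_swap₁₂, neg_neg]
  have n3 : F.con (fun p => F.con fun k => F.rm α.succ β.succ k p) = 0 :=
    F.con_con_of_antisymm fun _ _ => F.rm_swap₃₄ _ _ _ _
  have s : ∀ (κ : Fin m) (f : Fin (m + 1) → Fin (m + 1) → A),
      F.con (fun k => ∑ p, F.chr p μ.succ κ.succ * f p k)
        = ∑ ρ, F.slice.chr ρ μ κ * F.con (f ρ.succ)
          - F.h μ κ * F.con fun p => F.con fun k => f p k := by
    intro κ f
    rw [con_sum]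
    simp only [con_mul_left]
    rw [gauss_formula]
  simp only [drmN, e, con_sub]
  rw [s, s, s, n1, n2, n3]
  rw [← con_sub, D_con]
  simp only [MetricFrame.cov₃, Finset.sum_add_distrib, rmN]
  simp only [slice]
  ring

/-! ### The evolution of the second fundamental form -/

/-- First variation of the second fundamental form under `δ g = V`. -/
theorem variation_h (δ : Derivation ℝ A A) (hδ : ∀ i a, δ (F.D i a) = F.D i (δ a))
    (V : Fin (m + 1) → Fin (m + 1) → A) (hV : ∀ i j, δ (F.G i j) = V i j) (α β : Fin m) :
    2 * δ (F.h α β) = F.con (fun i => F.con fun j => V i j) * F.h α β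
      - F.con fun l => F.cov₂ V β.succ l α.succ + F.cov₂ V α.succ l β.succ
          - F.cov₂ V α.succ β.succ l := by
  have e1 : F.con (fun i => F.con fun j => V i j) = -(F.N * F.N * δ (F.Gi 0 0)) := by
    have := congrFun (congrFun (F.matD_Gi δ) 0) 0
    rw [matD_apply] at this
    rw [this]
    simp only [con, nu, Matrix.neg_apply, Matrix.mul_apply, matD_apply, hV, Finset.mul_sum,
      Finset.sum_mul, mul_neg, neg_neg]
    rw [Finset.sum_comm]
    refine Finset.sum_congr rfl fun j _ => Finset.sum_congr rfl fun i _ => ?_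
    rw [F.Gi_symm 0 i]; ring
  have e2 : 2 * δ F.N = F.N * F.con fun i => F.con fun j => V i j := by
    have := congrArg δ F.N_sq
    simp only [Derivation.leibniz, smul_eq_mul, Derivation.map_one_eq_zero] at this
    rw [e1]
    linear_combination F.N * this - 2 * δ F.N * F.N_sq
  have e3 : F.con (fun l => F.cov₂ V β.succ l α.succ + F.cov₂ V α.succ l β.succ
      - F.cov₂ V α.succ β.succ l) = -(2 * F.N * δ (F.chr 0 α.succ β.succ)) := by
    simp only [← F.variation_chr δ hδ V hV]
    rw [← F.raise_lower (fun k => δ (F.chr k α.succ β.succ)) 0, con, Finset.mul_sum,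
      ← Finset.sum_neg_distrib]
    refine Finset.sum_congr rfl fun l _ => ?_
    rw [nu, F.Gi_symm 0 l]; ring
  rw [e3, h_eq_chr, Derivation.leibniz, smul_eq_mul, smul_eq_mul]
  linear_combination F.chr 0 α.succ β.succ * e2

/-- `Rc(ν, ν)` as a boundary trace. -/
theorem con_con_ric : F.con (fun j => F.con fun k => F.ric j k) = F.slice.tr F.rmNN := by
  have e : ∀ j k, F.ric j k = F.con (fun i => F.con fun l => F.rm i j k l)
      + F.slice.tr fun γ δ => F.rm γ.succ j k δ.succ := fun j k => F.sum_Gi_split _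
  simp only [e, con_add]
  have z : F.con (fun j => F.con fun k => F.con fun i => F.con fun l => F.rm i j k l) = 0 := by
    have : ∀ j, (F.con fun k => F.con fun i => F.con fun l => F.rm i j k l)
        = F.con fun i => F.con fun k => F.con fun l => F.rm i j k l := fun j => F.con_comm _
    simp only [this]
    refine F.con_con_of_antisymm fun j i => ?_
    rw [← con_neg]; congr 1; ext k
    rw [← con_neg]; congr 1; ext l
    exact F.rm_swap₁₂ _ _ _ _
  rw [z, zero_add]
  simp only [con_tr]
  congr 1; ext γ δ
  rw [rmNN]
  congr 1; ext j; congr 1; ext k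
  rw [F.rm_swap₁₂, F.rm_swap₃₄, neg_neg]

/-- The component `R_{nαβn|n}`. -/
def drmNNN (α β : Fin m) : A :=
  F.con fun i => F.con fun l => F.con fun k => F.drm i α.succ β.succ l k

/-- The derivative `∇_α Rc(∂_β, ν)`: only the tangential part of the trace survives, by the
antisymmetry of `R` in its last two indices. -/
theorem con_cov₂_ric_mid (α β : Fin m) :
    F.con (fun l => F.cov₂ F.ric β.succ l α.succ) = F.slice.tr fun γ δ => F.drmN γ β δ α := by
  simp only [F.cov₂_ric, sum_Gi_split, con_add, con_tr]
  have z : F.con (fun k => F.con fun i => F.con fun l => F.drm i β.succ k l α.succ) = 0 := by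
    rw [con_comm]
    have : ∀ i, F.con (fun k => F.con fun l => F.drm i β.succ k l α.succ) = 0 := fun i =>
      F.con_con_of_antisymm fun k l => F.drm_swap₃₄ _ _ _ _ _
    simp only [this]
    simp [con]
  rw [z, zero_add]
  rfl

/-- The normal derivative of `Rc`, with the tangential part of the trace rewritten by means of the
second Bianchi identity. -/
theorem con_cov₂_ric_last (α β : Fin m) :
    F.con (fun k => F.cov₂ F.ric α.succ β.succ k)
      = F.drmNNN α β + F.slice.tr fun γ δ => F.drmN β δ α γ - F.drmN β δ γ α := by
  simp only [F.cov₂_ric, sum_Gi_split, con_add, con_tr]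
  congr 1
  · rw [drmNNN, con_comm]
    congr 1; ext i
    rw [con_comm]
  · congr 1; ext γ δ
    rw [drmN, drmN, ← con_sub]
    congr 1; ext k
    linear_combination F.drm_cyclic γ.succ α.succ β.succ δ.succ k
      - F.drm_pair α.succ k β.succ δ.succ γ.succ
      - F.drm_swap₃₄ β.succ δ.succ α.succ k γ.succ
      - F.drm_pair k γ.succ β.succ δ.succ α.succ

/-- The evolution of `h` under Ricci flow, before the derivatives of the curvature are rewritten
by means of the Codazzi equation. -/
theorem evolution_h_curvature (δ : Derivation ℝ A A) (hδ : ∀ i a, δ (F.D i a) = F.D i (δ a))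
    (hV : ∀ i j, δ (F.G i j) = -2 * F.ric i j) (α β : Fin m) :
    δ (F.h α β) = -(F.slice.tr F.rmNN * F.h α β) - F.drmNNN α β
      + F.slice.tr (fun γ δ => F.drmN γ α δ β) - F.slice.tr fun γ δ => F.drmN β δ α γ := by
  have hc : ∀ a b c, F.cov₂ (fun i j => -2 * F.ric i j) a b c = -2 * F.cov₂ F.ric a b c := by
    intro a b c
    have h2 : F.D c (-2 : A) = 0 := by
      simpa using (F.D c).map_natCast 2
    simp only [MetricFrame.cov₂, Derivation.leibniz, smul_eq_mul, h2, mul_sub, Finset.mul_sum]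
    rw [mul_zero, add_zero]
    congr 1
    exact Finset.sum_congr rfl fun _ _ => by ring
  have h := F.variation_h δ hδ _ hV α β
  simp only [hc, con_add, con_sub, con_mul_left, con_con_ric, con_cov₂_ric_mid,
    con_cov₂_ric_last] at h
  have sw : F.slice.tr (fun γ δ => F.drmN γ β δ α) = -F.slice.tr fun γ δ => F.drmN β δ γ α := by
    rw [← F.slice.tr_neg, ← F.slice.tr_swap]
    congr 1; ext γ δ
    rw [drmN, drmN, ← con_neg]
    congr 1; ext k
    rw [F.drm_swap₁₂]
  rw [F.slice.tr_sub, sw] at h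
  apply eq_of_two_mul_eq
  rw [h]; ring

theorem slice_cov₃_rmN (α β γ μ : Fin m) :
    F.slice.cov₃ F.rmN α β γ μ = F.slice.cov₃ (F.slice.cov₂ F.h) β γ α μ
      - F.slice.cov₃ (F.slice.cov₂ F.h) α γ β μ := by
  simp only [MetricFrame.cov₃, codazzi, map_sub, Finset.sum_add_distrib, mul_sub,
    Finset.sum_sub_distrib]
  ring

/-- The mean curvature. -/
def H : A := F.slice.tr F.h

/-- The Hessian of the mean curvature. -/
def hessH (α β : Fin m) : A :=
  F.D β.succ (F.D α.succ F.H) - ∑ p, F.slice.chr p β α * F.D p.succ F.H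

/-- The trace of `h_{γδ;αβ}` over `γδ` is the Hessian of the mean curvature. -/
theorem tr_cov₃_cov₂_h (α β : Fin m) :
    F.slice.tr (fun γ δ => F.slice.cov₃ (F.slice.cov₂ F.h) γ δ α β) = F.hessH α β := by
  have h : ∀ c, ∑ a, ∑ b, F.slice.Gi a b * F.slice.cov₂ F.h a b c = F.slice.D c F.H :=
    fun c => (F.slice.D_trace F.h c).symm
  rw [MetricFrame.tr, F.slice.trace_cov₃]
  simp only [h]
  rfl

/-- Simons' commutator: besides the Laplacian and the Hessian, the Codazzi equation contributes the
difference `h_{αδ;γβ} - h_{δα;βγ}`, which the Ricci identity expresses by the curvature of the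
induced metric. -/
theorem cov₃_cov₂_h_comm (α β γ δ : Fin m) :
    F.slice.cov₃ (F.slice.cov₂ F.h) α δ γ β - F.slice.cov₃ (F.slice.cov₂ F.h) δ α β γ
      = -F.slice.tr fun ρ σ => F.slice.rm β γ α σ * F.h ρ δ + F.slice.rm β γ δ σ * F.h α ρ := by
  rw [F.slice.cov₃_symm (F.slice.cov₂_symm F.h_symm) δ α, F.slice.cov₃_cov₂_comm]
  congr 1
  rw [MetricFrame.tr]
  refine Finset.sum_congr rfl fun p _ => ?_
  rw [F.slice.curvUp_eq_sum_rm, F.slice.curvUp_eq_sum_rm, Finset.sum_mul, Finset.sum_mul,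
    ← Finset.sum_add_distrib]
  exact Finset.sum_congr rfl fun q _ => by ring

/-- The evolution of the second fundamental form under Ricci flow, in terms of traces. -/
theorem evolution_h_tr (D : Derivation ℝ A A) (hD : ∀ i a, D (F.D i a) = F.D i (D a))
    (hV : ∀ i j, D (F.G i j) = -2 * F.ric i j) (α β : Fin m) :
    D (F.h α β) = F.slice.tr (fun γ δ => F.slice.cov₃ (F.slice.cov₂ F.h) α β γ δ)
      - F.hessH α β - F.drmNNN α β - F.H * F.rmNN α β
      - F.slice.tr (fun γ δ => F.slice.tr fun ρ σ =>
          F.h β ρ * F.rm α.succ δ.succ γ.succ σ.succ)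
      - F.slice.tr (fun γ δ => F.slice.tr fun ρ σ =>
          F.h δ ρ * F.rm β.succ γ.succ α.succ σ.succ)
      - F.H * F.slice.tr (fun ρ σ => F.h β ρ * F.h σ α)
      + F.slice.tr (fun γ δ => F.slice.tr fun ρ σ => F.h γ ρ * F.h δ σ) * F.h α β
      - F.slice.tr (fun γ δ => F.slice.tr fun ρ σ =>
          F.rm β.succ δ.succ γ.succ ρ.succ * F.h σ α + F.rm β.succ δ.succ α.succ ρ.succ * F.h σ γ)
      - F.slice.tr (fun γ δ => F.slice.tr fun ρ σ =>
          F.h β ρ * F.h δ α * F.h σ γ - F.h β γ * F.h δ ρ * F.h σ α) := by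
  have lap : F.slice.tr (fun γ δ => F.slice.cov₃ (F.slice.cov₂ F.h) α β γ δ)
      = F.slice.tr fun γ δ => F.slice.cov₃ (F.slice.cov₂ F.h) β α δ γ := by
    rw [← F.slice.tr_swap]
    congr 1; ext γ δ
    exact F.slice.cov₃_symm (F.slice.cov₂_symm F.h_symm) _ _ _ _
  have comm : F.slice.tr (fun γ δ => F.slice.cov₃ (F.slice.cov₂ F.h) α δ γ β)
      - F.slice.tr (fun γ δ => F.slice.cov₃ (F.slice.cov₂ F.h) δ α β γ)
      = -(F.slice.tr fun γ δ => F.slice.tr fun ρ σ =>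
          F.rm β.succ δ.succ γ.succ ρ.succ * F.h σ α + F.rm β.succ δ.succ α.succ ρ.succ * F.h σ γ)
        - (F.slice.tr fun γ δ => F.slice.tr fun ρ σ =>
          F.h β ρ * F.h δ α * F.h σ γ - F.h β γ * F.h δ ρ * F.h σ α)
        + (F.slice.tr fun γ δ => F.slice.tr fun ρ σ => F.h γ ρ * F.h δ σ) * F.h α β
        - F.H * F.slice.tr (fun ρ σ => F.h β ρ * F.h σ α) := by
    have l : (F.slice.tr fun γ δ => F.slice.tr fun ρ σ =>
          F.slice.rm β γ α σ * F.h ρ δ + F.slice.rm β γ δ σ * F.h α ρ)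
        = F.slice.tr fun γ δ => F.slice.tr fun ρ σ =>
          F.slice.rm β δ α ρ * F.h σ γ + F.slice.rm β δ γ ρ * F.h α σ := by
      rw [← F.slice.tr_swap]
      congr 1; ext γ δ
      rw [← F.slice.tr_swap]
    have a2 : (F.slice.tr fun γ δ => F.slice.tr fun ρ σ => F.h γ ρ * F.h δ σ)
        = F.slice.tr fun γ δ => F.slice.tr fun ρ σ => F.h γ σ * F.h δ ρ := by
      congr 1; ext γ δ
      rw [← F.slice.tr_swap]
    rw [← F.slice.tr_sub]
    simp only [cov₃_cov₂_h_comm]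
    rw [F.slice.tr_neg, l, a2, H]
    simp only [← F.slice.tr_mul_right, ← F.slice.tr_mul_left, ← F.slice.tr_neg, ← F.slice.tr_sub,
      ← F.slice.tr_add]
    congr 1; ext γ δ; congr 1; ext ρ σ
    rw [F.gauss, F.gauss, F.h_symm α β, F.h_symm α σ, F.h_symm δ γ, F.h_symm γ σ]
    ring
  have q1 : F.slice.tr (fun γ δ => F.h β γ * F.rmNN α δ)
      = F.slice.tr fun γ δ => F.h γ β * F.rmNN δ α := by
    congr 1; ext γ δ; rw [F.h_symm, F.rmNN_symm]
  have t1 : F.slice.tr (fun γ δ => F.slice.tr fun ρ σ =>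
        F.h β σ * F.rm γ.succ α.succ ρ.succ δ.succ)
      = F.slice.tr fun γ δ => F.slice.tr fun ρ σ =>
        F.h β ρ * F.rm α.succ δ.succ γ.succ σ.succ := by
    rw [← F.slice.tr_swap]
    congr 1; ext γ δ
    rw [← F.slice.tr_swap]
    congr 1; ext ρ σ
    rw [F.rm_swap₁₂ δ.succ, F.rm_swap₃₄ _ _ σ.succ, neg_neg]
  have t2 : F.slice.tr (fun γ δ => F.slice.tr fun ρ σ =>
        F.h γ σ * F.rm β.succ δ.succ ρ.succ α.succ)
      = -F.slice.tr fun γ δ => F.slice.tr fun ρ σ =>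
        F.h δ ρ * F.rm β.succ γ.succ α.succ σ.succ := by
    rw [← F.slice.tr_swap, ← F.slice.tr_neg]
    congr 1; ext γ δ
    rw [← F.slice.tr_swap, ← F.slice.tr_neg]
    congr 1; ext ρ σ
    rw [F.rm_swap₃₄ _ _ σ.succ]; ring
  rw [F.evolution_h_curvature D hD hV]
  simp only [drmN_eq, slice_cov₃_rmN, F.slice.tr_sub, F.slice.tr_add, F.slice.tr_mul_left,
    F.slice.tr_mul_right, tr_cov₃_cov₂_h] at comm ⊢
  rw [t1, t2, q1, lap, F.h_symm α β, F.rmNN_symm α β]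
  rw [F.h_symm α β] at comm
  rw [show F.slice.tr (fun γ δ => F.h γ δ) = F.H from rfl]
  linear_combination comm

end BoundaryFrame

/-! ### The ring of smooth functions on a subset of a normed space -/

section SmoothRing

/-- Extension of a function on `Ω` by zero. -/
def extendZero {E : Type*} {Ω : Set E} (f : Ω → ℝ) : E → ℝ := Function.extend Subtype.val f 0

theorem extendZero_apply {E : Type*} {Ω : Set E} (f : Ω → ℝ) (x : Ω) : extendZero f x = f x :=
  Subtype.val_injective.extend_apply _ _ _

theorem extendZero_eqOn {E : Type*} {Ω : Set E} {f : Ω → ℝ} {F : E → ℝ} (h : ∀ x : Ω, f x = F x) :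
    Set.EqOn (extendZero f) F Ω := fun x hx => by
  rw [← h ⟨x, hx⟩]; exact extendZero_apply f ⟨x, hx⟩

variable {E : Type*} [NormedAddCommGroup E] [NormedSpace ℝ E] {Ω : Set E}

variable (Ω) in
/-- The ring of functions on `Ω` that are smooth up to the boundary points contained in `Ω`. -/
def smoothRing : Subalgebra ℝ (Ω → ℝ) where
  carrier := {f | ContDiffOn ℝ ∞ (extendZero f) Ω}
  mul_mem' {f g} hf hg := (hf.mul hg).congr (extendZero_eqOn fun x => by
    simp [extendZero_apply])
  add_mem' {f g} hf hg := (hf.add hg).congr (extendZero_eqOn fun x => by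
    simp [extendZero_apply])
  algebraMap_mem' c := contDiffOn_const.congr (extendZero_eqOn (F := fun _ => c) fun x => by simp)

/-- The element of the ring of smooth functions given by a function that is smooth on `Ω`. -/
def smoothRing.of (F : E → ℝ) (hF : ContDiffOn ℝ ∞ F Ω) : smoothRing Ω :=
  ⟨fun x => F x, hF.congr (extendZero_eqOn fun _ => rfl)⟩

/-- Evaluation at a point of `Ω`. -/
def smoothRing.ev (x : Ω) : smoothRing Ω →ₐ[ℝ] ℝ :=
  (Pi.evalAlgHom ℝ (fun _ : Ω => ℝ) x).comp (smoothRing Ω).val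

open smoothRing

theorem smoothRing.ev_apply (x : Ω) (f : smoothRing Ω) : ev x f = extendZero f.1 x :=
  (extendZero_apply f.1 x).symm

@[simp] theorem smoothRing.ev_of (x : Ω) (F : E → ℝ) (hF : ContDiffOn ℝ ∞ F Ω) :
    ev x (of F hF) = F x := rfl

theorem smoothRing.ext_ev {f g : smoothRing Ω} (h : ∀ x, ev x f = ev x g) : f = g :=
  Subtype.ext (funext h)

theorem smoothRing.differentiableWithinAt (f : smoothRing Ω) (x : Ω) :
    DifferentiableWithinAt ℝ (extendZero f.1) Ω x :=
  (f.2.differentiableOn (by simp)) x x.2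

/-- The derivation of the ring of smooth functions given by a constant vector field. -/
def smoothRing.partialD (hΩ : UniqueDiffOn ℝ Ω) (v : E) :
    Derivation ℝ (smoothRing Ω) (smoothRing Ω) :=
  Derivation.mk'
    { toFun := fun f => of (fun x => fderivWithin ℝ (extendZero f.1) Ω x v)
        ((f.2.fderivWithin hΩ (by simp)).clm_apply contDiffOn_const)
      map_add' := fun f g => ext_ev fun x => by
        simp only [map_add, ev_of]
        rw [fderivWithin_congr' (extendZero_eqOn (F := extendZero f.1 + extendZero g.1) fun x => by
          simp [extendZero_apply]) x.2, fderivWithin_add (hΩ x x.2) (differentiableWithinAt f x)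
          (differentiableWithinAt g x)]
        rfl
      map_smul' := fun c f => ext_ev fun x => by
        simp only [map_smul, ev_of, RingHom.id_apply]
        rw [fderivWithin_congr' (extendZero_eqOn (F := c • extendZero f.1) fun x => by
          simp [extendZero_apply]) x.2, fderivWithin_const_smul (hΩ x x.2)
          (differentiableWithinAt f x)]
        rfl }
    fun f g => ext_ev fun x => by
      simp only [map_add, ev_of, smul_eq_mul, map_mul, LinearMap.coe_mk, AddHom.coe_mk]
      rw [fderivWithin_congr' (extendZero_eqOn (F := extendZero f.1 * extendZero g.1) fun x => by
          simp [extendZero_apply]) x.2, fderivWithin_mul (hΩ x x.2) (differentiableWithinAt f x)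
          (differentiableWithinAt g x)]
      simp [ev_apply]

theorem smoothRing.ev_partialD (hΩ : UniqueDiffOn ℝ Ω) (v : E) (f : smoothRing Ω) (x : Ω) :
    ev x (partialD hΩ v f) = fderivWithin ℝ (extendZero f.1) Ω x v := rfl

/-- Symmetry of the second derivative, also at the boundary points of `Ω`. -/
theorem smoothRing.partialD_comm (hΩ : UniqueDiffOn ℝ Ω) (hΩ' : Ω ⊆ closure (interior Ω)) (v w : E)
    (f : smoothRing Ω) :
    partialD hΩ v (partialD hΩ w f) = partialD hΩ w (partialD hΩ v f) := by
  refine ext_ev fun x => ?_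
  have key : ∀ v w, ev x (partialD hΩ v (partialD hΩ w f))
      = fderivWithin ℝ (fderivWithin ℝ (extendZero f.1) Ω) Ω x v w := by
    intro v w
    have hw : Set.EqOn (extendZero (partialD hΩ w f).1)
        (fun x => fderivWithin ℝ (extendZero f.1) Ω x w) Ω := extendZero_eqOn fun x => rfl
    rw [ev_partialD, fderivWithin_congr' hw x.2]
    have hd : DifferentiableWithinAt ℝ (fderivWithin ℝ (extendZero f.1) Ω) Ω x :=
      ((f.2.fderivWithin hΩ (m := ∞) (by simp)).differentiableOn (by simp)) x x.2
    rw [fderivWithin_clm_apply (hΩ x x.2) hd (differentiableWithinAt_const w)]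
    simp
  rw [key, key]
  exact (f.2 x x.2).isSymmSndFDerivWithinAt
    (by simpa using WithTop.coe_le_coe.2 (le_top : (2 : ℕ∞) ≤ ⊤)) hΩ (hΩ' x.2) x.2 v w

theorem smoothRing.isUnit_of_ne_zero (f : smoothRing Ω) (h : ∀ x, ev x f ≠ 0) : IsUnit f := by
  have hs : ContDiffOn ℝ ∞ (fun x => (extendZero f.1 x)⁻¹) Ω :=
    f.2.inv fun x hx => by rw [← ev_apply ⟨x, hx⟩]; exact h _
  refine IsUnit.of_mul_eq_one (of _ hs) (ext_ev fun x => ?_)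
  rw [map_mul, ev_of, ← ev_apply, mul_inv_cancel₀ (h x), map_one]

/-- The square root of a positive smooth function. -/
theorem smoothRing.exists_sqrt (f : smoothRing Ω) (h : ∀ x, 0 < ev x f) :
    ∃ s : smoothRing Ω, ∀ x, ev x s = Real.sqrt (ev x f) := by
  have hs : ContDiffOn ℝ ∞ (fun x => Real.sqrt (extendZero f.1 x)) Ω :=
    f.2.sqrt fun x hx => by rw [← ev_apply ⟨x, hx⟩]; exact (h _).ne'
  exact ⟨of _ hs, fun x => by rw [ev_of, ← ev_apply]⟩

/-- The pointwise inverse of a smooth matrix field is smooth. -/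
theorem smoothRing.exists_inv {n : Type*} [Fintype n] [DecidableEq n]
    (M : Matrix n n (smoothRing Ω)) (h : ∀ x, (M.map (ev x)).det ≠ 0) :
    ∃ N : Matrix n n (smoothRing Ω), M * N = 1 ∧ ∀ x, N.map (ev x) = (M.map (ev x))⁻¹ := by
  have hu : IsUnit M.det := isUnit_of_ne_zero _ fun x => by
    have := h x
    rwa [← AlgHom.mapMatrix_apply, ← AlgHom.map_det] at this
  refine ⟨M⁻¹, Matrix.mul_nonsing_inv _ hu, fun x => (Matrix.inv_eq_right_inv ?_).symm⟩
  have := congrArg (ev x).mapMatrix (Matrix.mul_nonsing_inv _ hu)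
  rwa [map_mul, map_one] at this

end SmoothRing

/-! ### Evaluation of the algebraic tensor calculus -/

section Realization

variable {d : ℕ} {A : Type*} [CommRing A] [Algebra ℝ A]

/-- The elements of `A` are interpreted, by means of the evaluations `ev y`, as functions on
`P ⊆ S`; the derivations `D i` are interpreted as the partial derivatives along `S`. -/
def Realizes (S P : Set (Coord d)) (ev : P → A →ₐ[ℝ] ℝ) (D : Fin d → Derivation ℝ A A) : Prop :=
  ∀ (f : Coord d → ℝ) (a : A), (∀ y : P, f y = ev y a) →
    ∀ (y : P) (i : Fin d), pd S i f y = ev y (D i a)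

/-- The matrix field `G` on `P ⊆ S` has the components and the inverse given by `F`. -/
structure RealizesMetric (S P : Set (Coord d)) (ev : P → A →ₐ[ℝ] ℝ) (F : MetricFrame (Fin d) A)
    (G : Coord d → Matrix (Fin d) (Fin d) ℝ) : Prop where
  pd_eq : Realizes S P ev F.D
  G_eq : ∀ (y : P) i j, G y i j = ev y (F.G i j)
  inv_eq : ∀ (y : P) i j, (G y)⁻¹ i j = ev y (F.Gi i j)

namespace RealizesMetric

variable {S P : Set (Coord d)} {ev : P → A →ₐ[ℝ] ℝ} {F : MetricFrame (Fin d) A}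
  {G : Coord d → Matrix (Fin d) (Fin d) ℝ} (h : RealizesMetric S P ev F G)

include h

theorem christoffel_eq (y : P) (k i j : Fin d) :
    christoffel G S y k i j = ev y (F.chr k i j) := by
  have e : ∀ a b c, pd S a (fun x => G x b c) y = ev y (F.D a (F.G b c)) := fun a b c =>
    h.pd_eq _ _ (fun y => h.G_eq y b c) y a
  simp only [christoffel, e, h.inv_eq, MetricFrame.chr, MetricFrame.chrLow, map_sum, map_mul,
    map_smul, map_add, map_sub, smul_eq_mul, Finset.mul_sum]
  exact Finset.sum_congr rfl fun _ _ => by ring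

theorem curvatureUp_eq (y : P) (i j k l : Fin d) :
    curvatureUp G S y i j k l = ev y (F.curvUp i j k l) := by
  have e : ∀ a k i j, pd S a (fun x => christoffel G S x k i j) y = ev y (F.D a (F.chr k i j)) :=
    fun a k i j => h.pd_eq _ _ (fun y => h.christoffel_eq y k i j) y a
  simp only [curvatureUp, e, h.christoffel_eq, MetricFrame.curvUp, map_sum, map_mul, map_add,
    map_sub]

theorem riem_eq (y : P) (i j k l : Fin d) : riem G S y i j k l = ev y (F.rm i j k l) := by
  simp only [riem, h.curvatureUp_eq, h.G_eq, MetricFrame.rm, map_sum, map_mul]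

theorem ricci_eq (y : P) (j k : Fin d) : ricci G S y j k = ev y (F.ric j k) := by
  simp only [ricci, h.riem_eq, h.inv_eq, MetricFrame.ric, map_sum, map_mul]

theorem covDeriv₁_eq {T : Coord d → Fin d → ℝ} {T' : Fin d → A}
    (hT : ∀ (y : P) a, T y a = ev y (T' a)) (y : P) (a c : Fin d) :
    covDeriv₁ G S T y a c = ev y (F.D c (T' a) - ∑ p, F.chr p c a * T' p) := by
  rw [covDeriv₁, h.pd_eq _ _ (fun y => hT y a) y c]
  simp only [h.christoffel_eq, hT, map_sum, map_mul, map_sub]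

theorem covDeriv₂_eq {T : Coord d → Fin d → Fin d → ℝ} {T' : Fin d → Fin d → A}
    (hT : ∀ (y : P) a b, T y a b = ev y (T' a b)) (y : P) (a b c : Fin d) :
    covDeriv₂ G S T y a b c = ev y (F.cov₂ T' a b c) := by
  rw [covDeriv₂, h.pd_eq _ _ (fun y => hT y a b) y c]
  simp only [MetricFrame.cov₂, h.christoffel_eq, hT, map_sum, map_mul, map_sub, map_add]

theorem covDeriv₃_eq {T : Coord d → Fin d → Fin d → Fin d → ℝ} {T' : Fin d → Fin d → Fin d → A}
    (hT : ∀ (y : P) a b c, T y a b c = ev y (T' a b c)) (y : P) (a b c e : Fin d) :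
    covDeriv₃ G S T y a b c e = ev y (F.cov₃ T' a b c e) := by
  rw [covDeriv₃, h.pd_eq _ _ (fun y => hT y a b c) y e]
  simp only [MetricFrame.cov₃, h.christoffel_eq, hT, map_sum, map_mul, map_sub, map_add]

theorem covDeriv₄_riem_eq (y : P) (a b c e f : Fin d) :
    covDeriv₄ G S (riem G S) y a b c e f = ev y (F.drm a b c e f) := by
  rw [covDeriv₄, h.pd_eq _ _ (fun y => h.riem_eq y a b c e) y f]
  simp only [MetricFrame.drm, MetricFrame.cov₄, h.christoffel_eq, h.riem_eq, map_sum, map_mul,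
    map_sub, map_add]

end RealizesMetric

/-- Restriction of smooth functions along an affine map `φ` with differential `L`. -/
theorem realizes_of_map {E : Type*} [NormedAddCommGroup E] [NormedSpace ℝ E] {Ω : Set E}
    (hΩ : UniqueDiffOn ℝ Ω) {S P : Set (Coord d)} (hS : UniqueDiffOn ℝ S) (hPS : P ⊆ S)
    (hP : ∀ y ∈ P, P ∈ nhdsWithin y S) (φ : Coord d → E) (L : Coord d →L[ℝ] E)
    (hφ : ∀ y, HasFDerivAt φ L y) (hmaps : Set.MapsTo φ P Ω) :
    Realizes S P (fun y => smoothRing.ev ⟨φ y, hmaps y.2⟩)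
      fun i => smoothRing.partialD hΩ (L (EuclideanSpace.single i 1)) := by
  intro f a hf y i
  rw [smoothRing.ev_partialD]
  have h1 : HasFDerivWithinAt (extendZero a.1 ∘ φ)
      ((fderivWithin ℝ (extendZero a.1) Ω (φ y)).comp L) P y :=
    HasFDerivWithinAt.comp (y : Coord d)
      (smoothRing.differentiableWithinAt a ⟨φ y, hmaps y.2⟩).hasFDerivWithinAt
      (hφ y).hasFDerivWithinAt hmaps
  have h2 : HasFDerivWithinAt f ((fderivWithin ℝ (extendZero a.1) Ω (φ y)).comp L) P y :=
    h1.congr (fun x hx => by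
      rw [hf ⟨x, hx⟩, smoothRing.ev_apply, Function.comp_apply]) (by
      rw [hf y, smoothRing.ev_apply, Function.comp_apply])
  rw [pd, (h2.mono_of_mem_nhdsWithin (hP y y.2)).fderivWithin (hS y (hPS y.2))]
  rfl

end Realization

/-! ### Ricci flow in a coordinate domain of the half-space -/

section HalfSpace

variable {m : ℕ}

/-- The differential of the inclusion of the boundary. -/
def inclL (m : ℕ) : Coord m →L[ℝ] Coord (m + 1) :=
  LinearMap.toContinuousLinearMap
    { toFun := incl
      map_add' := fun x y => by
        ext i; refine Fin.cases ?_ (fun _ => ?_) i <;> simp [incl]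
      map_smul' := fun c x => by
        ext i; refine Fin.cases ?_ (fun _ => ?_) i <;> simp [incl] }

theorem incl_single (α : Fin m) :
    incl (EuclideanSpace.single α (1 : ℝ)) = EuclideanSpace.single α.succ (1 : ℝ) := by
  ext i
  refine Fin.cases ?_ (fun j => ?_) i
  · simp [incl, (Fin.succ_ne_zero α).symm]
  · simp [incl]

theorem convex_halfSpace : Convex ℝ (halfSpace m) := by
  intro x hx y hy a b ha hb _
  change 0 ≤ x 0 at hx
  change 0 ≤ y 0 at hy
  change 0 ≤ (a • x + b • y) 0
  simpa using add_nonneg (mul_nonneg ha hx) (mul_nonneg hb hy)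

theorem interior_halfSpace_nonempty : (interior (halfSpace m)).Nonempty := by
  refine ⟨EuclideanSpace.single 0 1, mem_interior.2 ⟨{y | 0 < y 0}, fun y (hy : 0 < y 0) => le_of_lt (b := y 0) hy,
    isOpen_lt continuous_const (by fun_prop), ?_⟩⟩
  simp

theorem interior_prod_halfSpace_nonempty {J : Set ℝ} (hJ : J.OrdConnected) (hJ' : J.Nontrivial) :
    (interior (J ×ˢ halfSpace m)).Nonempty := by
  rw [interior_prod_eq]
  refine Set.Nonempty.prod ?_ interior_halfSpace_nonempty
  obtain ⟨a, ha, b, hb, hab⟩ := hJ'.exists_lt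
  refine ⟨(a + b) / 2, mem_interior.2 ⟨Set.Ioo a b,
    fun x hx => hJ.out ha hb (Set.Ioo_subset_Icc_self hx), isOpen_Ioo, ?_, ?_⟩⟩ <;> linarith

theorem subset_closure_interior_inter {E : Type*} [NormedAddCommGroup E] [NormedSpace ℝ E]
    {C V : Set E} (hC : Convex ℝ C) (hC' : (interior C).Nonempty) (hV : IsOpen V) :
    V ∩ C ⊆ closure (interior (V ∩ C)) := by
  rw [interior_inter, hV.interior_eq]
  refine subset_trans ?_ hV.inter_closure
  refine Set.inter_subset_inter_right _ ?_
  rw [hC.closure_interior_eq_closure_of_nonempty_interior hC']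
  exact subset_closure

/-- A family of metrics on a coordinate domain `U`, together with the induced metrics on the
hypersurfaces `y⁰ = const`, as a `BoundaryFrame` over the ring of smooth functions in space and
time. -/
theorem exists_boundaryFrame {Ω : Set (ℝ × Coord (m + 1))} (hΩ : UniqueDiffOn ℝ Ω)
    (hΩ' : Ω ⊆ closure (interior Ω))
    (G : ℝ → Coord (m + 1) → Matrix (Fin (m + 1)) (Fin (m + 1)) ℝ)
    (hsmooth : ∀ i j, ContDiffOn ℝ ∞ (fun q : ℝ × Coord (m + 1) => G q.1 q.2 i j) Ω)
    (hpos : ∀ x ∈ Ω, (G x.1 x.2).PosDef) :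
    ∃ F : BoundaryFrame m (smoothRing Ω),
      (∀ i, F.D i = smoothRing.partialD hΩ (0, EuclideanSpace.single i 1)) ∧
      (∀ (x : Ω) i j, G x.1.1 x.1.2 i j = smoothRing.ev x (F.G i j)) ∧
      (∀ (x : Ω) i j, (G x.1.1 x.1.2)⁻¹ i j = smoothRing.ev x (F.Gi i j)) ∧
      (∀ (x : Ω), smoothRing.ev x F.N = (Real.sqrt ((G x.1.1 x.1.2)⁻¹ 0 0))⁻¹) ∧
      ∀ (x : Ω) α β, (Matrix.of fun α β : Fin m => G x.1.1 x.1.2 α.succ β.succ)⁻¹ α β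
        = smoothRing.ev x (F.b α β) := by
  let M : Matrix (Fin (m + 1)) (Fin (m + 1)) (smoothRing Ω) :=
    Matrix.of fun i j => smoothRing.of _ (hsmooth i j)
  have hM : ∀ x : Ω, M.map (smoothRing.ev x) = G x.1.1 x.1.2 := fun x => rfl
  have hpos' : ∀ x : Ω, (Matrix.of fun α β : Fin m => G x.1.1 x.1.2 α.succ β.succ).PosDef :=
    fun x => (hpos x x.2).submatrix (Fin.succ_injective m)
  obtain ⟨Mi, hMi, hMi'⟩ := smoothRing.exists_inv M fun x => by
    rw [hM]; exact (hpos x x.2).det_pos.ne'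
  obtain ⟨b, hb, hb'⟩ := smoothRing.exists_inv
    (Matrix.of fun α β : Fin m => M α.succ β.succ) fun x => (hpos' x).det_pos.ne'
  have hpos0 : ∀ x : Ω, 0 < smoothRing.ev x (Mi 0 0) := fun x => by
    have := congrFun (congrFun (hMi' x) 0) 0
    rw [Matrix.map_apply] at this
    rw [this, hM]
    exact (hpos x x.2).inv.diag_pos
  obtain ⟨s, hs⟩ := smoothRing.exists_sqrt _ hpos0
  have hs0 : ∀ x, smoothRing.ev x s ≠ 0 := fun x => by
    rw [hs]; exact (Real.sqrt_pos.2 (hpos0 x)).ne'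
  obtain ⟨N, hN⟩ := (smoothRing.isUnit_of_ne_zero s hs0).exists_right_inv
  have hNs : ∀ x, smoothRing.ev x N = (smoothRing.ev x s)⁻¹ := fun x => by
    have := congrArg (smoothRing.ev x) hN
    rw [map_mul, map_one] at this
    exact eq_inv_of_mul_eq_one_right this
  refine ⟨{ D := fun i => smoothRing.partialD hΩ (0, EuclideanSpace.single i 1)
            comm := fun i j a => smoothRing.partialD_comm hΩ hΩ' _ _ a
            G := M
            Gi := Mi
            symm := fun i j => smoothRing.ext_ev fun x => ?_
            mul_inv := hMi
            N := N
            N_sq := smoothRing.ext_ev fun x => ?_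
            b := b
            mul_b := hb }, fun i => rfl, fun x i j => rfl, fun x i j => ?_, fun x => ?_,
    fun x α β => ?_⟩
  · have : G x.1.1 x.1.2 i j = G x.1.1 x.1.2 j i := by
      simpa using ((hpos x x.2).isHermitian.apply i j).symm
    exact this
  · have h2 := Real.mul_self_sqrt (hpos0 x).le
    rw [← hs] at h2
    rw [map_mul, map_mul, hNs, map_one, ← h2]
    field_simp [hs0 x]
  · rw [← hM, ← hMi']; rfl
  · rw [hNs, hs, ← hM, ← hMi']; rfl
  · exact (congrFun (congrFun (hb' x) α) β).symm

/-- The metric `G` on `U` and the induced metric on the boundary have the components given by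
`F`. -/
structure RealizesBoundary {A : Type*} [CommRing A] [Algebra ℝ A] (U : Set (Coord (m + 1)))
    (ev : U → A →ₐ[ℝ] ℝ) (F : BoundaryFrame m A)
    (G : Coord (m + 1) → Matrix (Fin (m + 1)) (Fin (m + 1)) ℝ) : Prop where
  ambient : RealizesMetric (halfSpace m) U ev F.toMetricFrame G
  boundary : RealizesMetric Set.univ (incl ⁻¹' U) (fun z => ev ⟨incl z, z.2⟩) F.slice
    (bdryMetric G)
  N_eq : ∀ y : U, ev y F.N = (Real.sqrt ((G y)⁻¹ 0 0))⁻¹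

namespace RealizesBoundary

variable {A : Type*} [CommRing A] [Algebra ℝ A] {U : Set (Coord (m + 1))}
  {ev : U → A →ₐ[ℝ] ℝ} {F : BoundaryFrame m A}
  {G : Coord (m + 1) → Matrix (Fin (m + 1)) (Fin (m + 1)) ℝ} (h : RealizesBoundary U ev F G)

include h

theorem normal_eq (z : incl ⁻¹' U) (i : Fin (m + 1)) :
    normal G z i = ev ⟨incl z, z.2⟩ (F.nu i) := by
  rw [normal, BoundaryFrame.nu, map_neg, map_mul, h.N_eq, ← h.ambient.inv_eq]
  ring

theorem sff_eq (z : incl ⁻¹' U) (α β : Fin m) :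
    sff G z α β = ev ⟨incl z, z.2⟩ (F.h α β) := by
  simp only [sff, BoundaryFrame.h, h.normal_eq, h.ambient.christoffel_eq ⟨incl z, z.2⟩,
    h.ambient.G_eq ⟨incl z, z.2⟩, map_neg, map_sum, map_mul]

theorem bdryInv_eq (z : incl ⁻¹' U) (α β : Fin m) :
    (bdryMetric G z)⁻¹ α β = ev ⟨incl z, z.2⟩ (F.slice.Gi α β) :=
  h.boundary.inv_eq z α β

theorem meanCurv_eq (z : incl ⁻¹' U) : meanCurv G z = ev ⟨incl z, z.2⟩ F.H := by
  simp only [meanCurv, BoundaryFrame.H, MetricFrame.tr, h.sff_eq, h.bdryInv_eq, map_sum, map_mul]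

theorem sffNormSq_eq (z : incl ⁻¹' U) :
    sffNormSq G z
      = ev ⟨incl z, z.2⟩ (F.slice.tr fun γ δ => F.slice.tr fun ρ σ => F.h γ ρ * F.h δ σ) := by
  simp only [sffNormSq, MetricFrame.tr, h.sff_eq, h.bdryInv_eq, map_sum, map_mul, Finset.mul_sum]
  refine Finset.sum_congr rfl fun γ _ => ?_
  rw [Finset.sum_comm]
  refine Finset.sum_congr rfl fun δ _ => Finset.sum_congr rfl fun ρ _ =>
    Finset.sum_congr rfl fun σ _ => ?_
  ring

theorem hessMeanCurv_eq (z : incl ⁻¹' U) (α β : Fin m) :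
    hessMeanCurv G z α β = ev ⟨incl z, z.2⟩ (F.hessH α β) :=
  h.boundary.covDeriv₁_eq (T' := fun γ => F.D γ.succ F.H)
    (fun y γ => h.boundary.pd_eq _ _ h.meanCurv_eq y γ) z α β

theorem lapSff_eq (z : incl ⁻¹' U) (α β : Fin m) :
    lapSff G z α β = ev ⟨incl z, z.2⟩
      (F.slice.tr fun γ δ => F.slice.cov₃ (F.slice.cov₂ F.h) α β γ δ) := by
  simp only [lapSff, MetricFrame.tr, h.bdryInv_eq, map_sum, map_mul,
    h.boundary.covDeriv₃_eq (fun y => h.boundary.covDeriv₂_eq h.sff_eq y) z]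

theorem riemTan_eq (z : incl ⁻¹' U) (α β γ δ : Fin m) :
    riemTan G z α β γ δ = ev ⟨incl z, z.2⟩ (F.rm α.succ β.succ γ.succ δ.succ) :=
  h.ambient.riem_eq ⟨incl z, z.2⟩ _ _ _ _

theorem riemNor_eq (z : incl ⁻¹' U) (α β : Fin m) :
    riemNor G z α β = ev ⟨incl z, z.2⟩ (F.rmNN α β) := by
  simp only [riemNor, BoundaryFrame.rmNN, BoundaryFrame.con, h.normal_eq,
    h.ambient.riem_eq ⟨incl z, z.2⟩, map_sum, map_mul, Finset.mul_sum, mul_assoc]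

theorem covRiemNor_eq (z : incl ⁻¹' U) (α β : Fin m) :
    covRiemNor G z α β = ev ⟨incl z, z.2⟩ (F.drmNNN α β) := by
  simp only [covRiemNor, BoundaryFrame.drmNNN, BoundaryFrame.con, h.normal_eq,
    h.ambient.covDeriv₄_riem_eq ⟨incl z, z.2⟩, map_sum, map_mul, Finset.mul_sum, mul_assoc]

end RealizesBoundary

/-- The evolution equation for a family of metrics on a relatively open subset `U` of the
half-space. -/
theorem hasDerivWithinAt_sff {J : Set ℝ} (hJ : J.OrdConnected) (hJ' : J.Nontrivial)
    {V U : Set (Coord (m + 1))} (hV : IsOpen V) (hU : U = V ∩ halfSpace m)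
    (G : ℝ → Coord (m + 1) → Matrix (Fin (m + 1)) (Fin (m + 1)) ℝ)
    (hsmooth : ∀ i j, ContDiffOn ℝ ∞ (fun q : ℝ × Coord (m + 1) => G q.1 q.2 i j) (J ×ˢ U))
    (hpos : ∀ t ∈ J, ∀ y ∈ U, (G t y).PosDef)
    (hflow : ∀ t ∈ J, ∀ y ∈ U, ∀ i j,
      HasDerivWithinAt (fun s => G s y i j) (-2 * ricci (G t) (halfSpace m) y i j) J t)
    {t : ℝ} (ht : t ∈ J) {z : Coord m} (hz : incl z ∈ U) (α β : Fin m) :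
    let b := (bdryMetric (G t) z)⁻¹
    let h := sff (G t) z
    let R := riemTan (G t) z
    HasDerivWithinAt (fun s => sff (G s) z α β)
      (lapSff (G t) z α β - hessMeanCurv (G t) z α β - covRiemNor (G t) z α β
        - meanCurv (G t) z * riemNor (G t) z α β
        - (∑ γ, ∑ δ, ∑ ρ, ∑ σ, b γ δ * b ρ σ * h β ρ * R α δ γ σ)
        - (∑ γ, ∑ δ, ∑ ρ, ∑ σ, b γ δ * b ρ σ * h δ ρ * R β γ α σ)
        - meanCurv (G t) z * (∑ ρ, ∑ σ, b ρ σ * h β ρ * h σ α)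
        + sffNormSq (G t) z * h α β
        - (∑ γ, ∑ δ, ∑ ρ, ∑ σ, b γ δ * b ρ σ * (R β δ γ ρ * h σ α + R β δ α ρ * h σ γ))
        - (∑ γ, ∑ δ, ∑ ρ, ∑ σ, b γ δ * b ρ σ *
            (h β ρ * h δ α * h σ γ - h β γ * h δ ρ * h σ α)))
      J t := by
  have hUS : U ⊆ halfSpace m := hU ▸ Set.inter_subset_right
  have hconv : Convex ℝ (J ×ˢ halfSpace m) := hJ.convex.prod convex_halfSpace
  have hne := interior_prod_halfSpace_nonempty (m := m) hJ hJ'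
  have hΩe : J ×ˢ U = (Set.univ ×ˢ V) ∩ (J ×ˢ halfSpace m) := by
    rw [Set.prod_inter_prod, Set.univ_inter, hU]
  have hVo : IsOpen ((Set.univ : Set ℝ) ×ˢ V) := isOpen_univ.prod hV
  have hΩ : UniqueDiffOn ℝ (J ×ˢ U) := by
    rw [hΩe, Set.inter_comm]
    exact (uniqueDiffOn_convex hconv hne).inter hVo
  have hΩ' : J ×ˢ U ⊆ closure (interior (J ×ˢ U)) := by
    rw [hΩe]
    exact subset_closure_interior_inter hconv hne hVo
  have hUn : ∀ y ∈ U, U ∈ nhdsWithin y (halfSpace m) := fun y hy => by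
    rw [hU] at hy ⊢
    exact Filter.inter_mem (mem_nhdsWithin_of_mem_nhds (hV.mem_nhds hy.1)) self_mem_nhdsWithin
  obtain ⟨F, hD, hG, hGi, hN, hb⟩ := exists_boundaryFrame hΩ hΩ' G hsmooth
    fun x hx => hpos x.1 hx.1 x.2 hx.2
  -- At each time, evaluation along `y ↦ (s, y)` and along `z ↦ (s, (0, z))` turns the algebraic
  -- tensors into those of `G s` and of its boundary metric.
  have hF : ∀ s (hs : s ∈ J), RealizesBoundary U
      (fun y => smoothRing.ev (⟨(s, y), hs, y.2⟩ : ↥(J ×ˢ U))) F (G s) := by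
    intro s hs
    refine ⟨⟨?_, fun y i j => hG ⟨(s, y), hs, y.2⟩ i j, fun y i j => hGi ⟨(s, y), hs, y.2⟩ i j⟩,
      ⟨?_, fun y i j => hG ⟨(s, incl y), hs, y.2⟩ _ _,
        fun y i j => hb ⟨(s, incl y), hs, y.2⟩ i j⟩, fun y => hN ⟨(s, y), hs, y.2⟩⟩
    · have := realizes_of_map hΩ (uniqueDiffOn_convex convex_halfSpace interior_halfSpace_nonempty)
        hUS hUn (fun y => (s, y)) (ContinuousLinearMap.inr ℝ ℝ _)
        (fun y => hasFDerivAt_prodMk_right s y) (fun y hy => ⟨hs, hy⟩)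
      have e : F.D = _ := funext hD
      rw [e]
      exact this
    · have hL : ∀ y : Coord m, HasFDerivAt (fun y : Coord m => (s, incl y))
          ((ContinuousLinearMap.inr ℝ ℝ _).comp (inclL m)) y := fun y =>
        (hasFDerivAt_prodMk_right s (incl y)).comp y (inclL m).hasFDerivAt
      have hPn : ∀ y ∈ incl ⁻¹' U, incl ⁻¹' U ∈ nhdsWithin y Set.univ := by
        intro y hy
        have : incl ⁻¹' U = inclL m ⁻¹' V := by
          ext x
          rw [hU]
          exact and_iff_left (le_refl (0 : ℝ))
        rw [nhdsWithin_univ]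
        rw [this] at hy ⊢
        exact (hV.preimage (inclL m).continuous).mem_nhds hy
      have := realizes_of_map hΩ uniqueDiffOn_univ (Set.subset_univ _) hPn
        (fun y : Coord m => (s, incl y)) ((ContinuousLinearMap.inr ℝ ℝ _).comp (inclL m)) hL
        (show Set.MapsTo _ (incl ⁻¹' U) (J ×ˢ U) from fun y hy => ⟨hs, hy⟩)
      have e : F.slice.D
          = fun α => smoothRing.partialD hΩ (0, EuclideanSpace.single (Fin.succ α) 1) :=
        funext fun α => hD α.succ
      rw [e]
      simp only [← incl_single]
      exact this
  -- The time derivative is the derivation in the direction `(1, 0)`.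
  have htime : ∀ (a : smoothRing (J ×ˢ U)) (x : ↥(J ×ˢ U)) (f : ℝ → ℝ),
      (∀ s (hs : s ∈ J), f s = smoothRing.ev (⟨(s, x.1.2), hs, x.2.2⟩ : ↥(J ×ˢ U)) a) →
      HasDerivWithinAt f (smoothRing.ev x (smoothRing.partialD hΩ (1, 0) a)) J x.1.1 := by
    intro a x f hf
    have h1 := (smoothRing.differentiableWithinAt a x).hasFDerivWithinAt.comp_hasDerivWithinAt
      (f := fun s : ℝ => (s, x.1.2)) x.1.1 (s := J)
      ((hasDerivAt_id x.1.1).prodMk (hasDerivAt_const x.1.1 x.1.2)).hasDerivWithinAt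
      (fun s hs => ⟨hs, x.2.2⟩)
    refine h1.congr (fun s hs => ?_) ?_
    · rw [hf s hs, smoothRing.ev_apply]; rfl
    · rw [hf x.1.1 x.2.1, smoothRing.ev_apply]; rfl
  have hJu : UniqueDiffOn ℝ J := uniqueDiffOn_convex hJ.convex (by
    rw [interior_prod_eq] at hne; exact hne.fst)
  have hV : ∀ i j, smoothRing.partialD hΩ (1, 0) (F.G i j) = -2 * F.ric i j := by
    refine fun i j => smoothRing.ext_ev fun x => ?_
    have h1 := htime (F.G i j) x (fun s => G s x.1.2 i j) fun s hs =>
      hG ⟨(s, x.1.2), hs, x.2.2⟩ i j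
    have h2 := hflow x.1.1 x.2.1 x.1.2 x.2.2 i j
    rw [(hF x.1.1 x.2.1).ambient.ricci_eq ⟨x.1.2, x.2.2⟩] at h2
    rw [(hJu x.1.1 x.2.1).eq_deriv _ h1 h2, map_mul, map_neg, map_ofNat]
  have hev := F.evolution_h_tr (smoothRing.partialD hΩ (1, 0))
    (fun i a => by rw [hD]; exact smoothRing.partialD_comm hΩ hΩ' _ _ a) hV α β
  have key := htime (F.h α β) ⟨(t, incl z), ht, hz⟩ (fun s => sff (G s) z α β)
    fun s hs => (hF s hs).sff_eq ⟨z, hz⟩ α β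
  rw [hev] at key
  have hFt := hF t ht
  intro b h R
  refine key.congr_deriv ?_
  have eb : ∀ α β, b α β = _ := hFt.bdryInv_eq ⟨z, hz⟩
  have eh : ∀ α β, h α β = _ := hFt.sff_eq ⟨z, hz⟩
  have eR : ∀ α β γ δ, R α β γ δ = _ := hFt.riemTan_eq ⟨z, hz⟩
  rw [hFt.lapSff_eq ⟨z, hz⟩, hFt.hessMeanCurv_eq ⟨z, hz⟩, hFt.covRiemNor_eq ⟨z, hz⟩,
    hFt.meanCurv_eq ⟨z, hz⟩, hFt.riemNor_eq ⟨z, hz⟩, hFt.sffNormSq_eq ⟨z, hz⟩]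
  simp only [eb, eh, eR, map_add, map_sub, map_mul]
  simp only [MetricFrame.tr, map_sum, map_mul, map_add, map_sub, Finset.mul_sum, mul_assoc]

end HalfSpace

/-! ### Metrics in charts of a manifold with boundary -/

section Manifold

/-- The Gram matrix of the image of the standard basis under an injective map. -/
theorem posDef_of_injective {d : ℕ} {E : Type*} [AddCommGroup E] [Module ℝ E] [TopologicalSpace E]
    (B : E →L[ℝ] E →L[ℝ] ℝ) (hs : ∀ v w, B v w = B w v) (hp : ∀ v, v ≠ 0 → 0 < B v v)
    (L : Coord d →L[ℝ] E) (hL : Function.Injective L) :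
    (Matrix.of fun i j : Fin d =>
      B (L (EuclideanSpace.single i 1)) (L (EuclideanSpace.single j 1))).PosDef := by
  refine Matrix.PosDef.of_dotProduct_mulVec_pos (by ext i j; simpa using hs _ _) fun x hx => ?_
  have e : WithLp.toLp 2 x = ∑ i, x i • (EuclideanSpace.single i 1 : Coord d) := by
    ext j; simp [Pi.single_apply]
  have h := hp (L (WithLp.toLp 2 x)) fun h0 => hx <| by
    have := hL (h0.trans (map_zero L).symm)
    simpa using this
  rw [e] at h
  simp only [map_sum, map_smul, sum_apply, smul_apply, smul_eq_mul] at h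
  simp only [dotProduct, Matrix.mulVec, Matrix.of_apply, star_trivial]
  refine h.trans_eq (Finset.sum_congr rfl fun i _ => ?_)
  congr 1
  exact Finset.sum_congr rfl fun j _ => by rw [hs, mul_comm]

variable {m : ℕ} {M : Type*} [TopologicalSpace M]

theorem range_modelWithCorners : Set.range (𝓡∂ (m + 1)) = halfSpace m :=
  range_modelWithCornersEuclideanHalfSpace (m + 1)

theorem extend_target_eq (e : OpenPartialHomeomorph M (EuclideanHalfSpace (m + 1))) :
    ∃ V : Set (Coord (m + 1)), IsOpen V ∧ (e.extend (𝓡∂ (m + 1))).target = V ∩ halfSpace m :=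
  ⟨_, e.open_target.preimage (𝓡∂ (m + 1)).continuous_symm, by
    rw [e.extend_target, range_modelWithCorners]⟩

variable [ChartedSpace (EuclideanHalfSpace (m + 1)) M]

/-- The coordinate fields of a chart are linearly independent. -/
theorem mfderivWithin_extend_symm_injective
    {e : OpenPartialHomeomorph M (EuclideanHalfSpace (m + 1))}
    (he : e ∈ IsManifold.maximalAtlas (𝓡∂ (m + 1)) ∞ M) {y : Coord (m + 1)}
    (hy : y ∈ (e.extend (𝓡∂ (m + 1))).target) :
    Function.Injective (mfderivWithin 𝓘(ℝ, Coord (m + 1)) (𝓡∂ (m + 1))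
      (e.extend (𝓡∂ (m + 1))).symm (halfSpace m) y) := by
  have hn : (e.extend (𝓡∂ (m + 1))).target ∈ nhdsWithin y (halfSpace m) := by
    obtain ⟨V, hV, hVe⟩ := extend_target_eq e
    rw [hVe] at hy ⊢
    exact Filter.inter_mem (mem_nhdsWithin_of_mem_nhds (hV.mem_nhds hy.1)) self_mem_nhdsWithin
  have hf : MDifferentiableWithinAt 𝓘(ℝ, Coord (m + 1)) (𝓡∂ (m + 1))
      (e.extend (𝓡∂ (m + 1))).symm (halfSpace m) y := by
    have := contMDiffOn_extend_symm he
    rw [← e.extend_target'] at this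
    exact ((this y hy).mono_of_mem_nhdsWithin hn).mdifferentiableWithinAt (by simp)
  have hs : (e.extend (𝓡∂ (m + 1))).symm y ∈ e.source := by
    rw [← e.extend_source (I := 𝓡∂ (m + 1))]
    exact (e.extend (𝓡∂ (m + 1))).map_target hy
  have hg := (e.contMDiffAt_extend he hs).mdifferentiableAt (by simp)
  have h1 := hg.hasMFDerivAt.comp_hasMFDerivWithinAt y hf.hasMFDerivWithinAt
  have h2 : HasMFDerivWithinAt 𝓘(ℝ, Coord (m + 1)) 𝓘(ℝ, Coord (m + 1))
      (e.extend (𝓡∂ (m + 1)) ∘ (e.extend (𝓡∂ (m + 1))).symm) (halfSpace m) y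
      (ContinuousLinearMap.id ℝ (Coord (m + 1))) :=
    (hasMFDerivAt_id y).hasMFDerivWithinAt.congr_of_eventuallyEq
      (Filter.eventuallyEq_of_mem hn fun x hx => (e.extend (𝓡∂ (m + 1))).right_inv hx)
      ((e.extend (𝓡∂ (m + 1))).right_inv hy)
  have hu : UniqueDiffWithinAt ℝ (halfSpace m) y :=
    uniqueDiffOn_convex convex_halfSpace interior_halfSpace_nonempty y
      (extend_target_eq e |>.choose_spec.2 ▸ hy).2
  have h3 : ∀ L : Coord (m + 1) →L[ℝ] Coord (m + 1),
      HasMFDerivWithinAt 𝓘(ℝ, Coord (m + 1)) 𝓘(ℝ, Coord (m + 1))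
        (e.extend (𝓡∂ (m + 1)) ∘ (e.extend (𝓡∂ (m + 1))).symm) (halfSpace m) y L →
      ∀ v, L v = v := fun L hL v => by
    have a : HasFDerivWithinAt (e.extend (𝓡∂ (m + 1)) ∘ (e.extend (𝓡∂ (m + 1))).symm) L
      (halfSpace m) y := hasMFDerivWithinAt_iff_hasFDerivWithinAt.1 hL
    have b : HasFDerivWithinAt (e.extend (𝓡∂ (m + 1)) ∘ (e.extend (𝓡∂ (m + 1))).symm)
      (ContinuousLinearMap.id ℝ (Coord (m + 1))) (halfSpace m) y :=
      hasMFDerivWithinAt_iff_hasFDerivWithinAt.1 h2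
    rw [hu.eq a b]
    rfl
  intro v w hvw
  have h4 := congrArg (mfderiv (𝓡∂ (m + 1)) 𝓘(ℝ, Coord (m + 1)) (e.extend (𝓡∂ (m + 1)))
    ((e.extend (𝓡∂ (m + 1))).symm y)) hvw
  exact (h3 _ h1 v).symm.trans (h4.trans (h3 _ h1 w))

theorem posDef_metricInChart
    (g : Bundle.RiemannianMetric (TangentSpace (𝓡∂ (m + 1)) : M → Type _))
    {e : OpenPartialHomeomorph M (EuclideanHalfSpace (m + 1))}
    (he : e ∈ IsManifold.maximalAtlas (𝓡∂ (m + 1)) ∞ M) {y : Coord (m + 1)}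
    (hy : y ∈ (e.extend (𝓡∂ (m + 1))).target) : (metricInChart g e y).PosDef :=
  posDef_of_injective (g.inner _) (g.symm _) (g.pos _) _
    (mfderivWithin_extend_symm_injective he hy)

end Manifold

end BoundaryRicciFlow

end

open BoundaryRicciFlow in
theorem mainTheorem5 {m : ℕ} {M : Type*} [TopologicalSpace M]
    [ChartedSpace (EuclideanHalfSpace (m + 1)) M] [IsManifold (𝓡∂ (m + 1)) ∞ M]
    (J : Set ℝ) (hJ : J.OrdConnected)
    (g : ℝ → Bundle.RiemannianMetric (TangentSpace (𝓡∂ (m + 1)) : M → Type _))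
    (hsmooth : IsSmoothFamily g J) (hflow : IsRicciFlow g J)
    (e : OpenPartialHomeomorph M (EuclideanHalfSpace (m + 1)))
    (he : e ∈ IsManifold.maximalAtlas (𝓡∂ (m + 1)) ∞ M)
    (t : ℝ) (ht : t ∈ J) (z : Coord m) (hz : incl z ∈ (e.extend (𝓡∂ (m + 1))).target)
    (α β : Fin m) :
    let G := metricInChart (g t) e
    let b := (bdryMetric G z)⁻¹
    let h := sff G z
    let R := riemTan G z
    HasDerivWithinAt (fun s => sff (metricInChart (g s) e) z α β)
      (lapSff G z α β - hessMeanCurv G z α β - covRiemNor G z α β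
        - meanCurv G z * riemNor G z α β
        - (∑ γ, ∑ δ, ∑ ρ, ∑ σ, b γ δ * b ρ σ * h β ρ * R α δ γ σ)
        - (∑ γ, ∑ δ, ∑ ρ, ∑ σ, b γ δ * b ρ σ * h δ ρ * R β γ α σ)
        - meanCurv G z * (∑ ρ, ∑ σ, b ρ σ * h β ρ * h σ α)
        + sffNormSq G z * h α β
        - (∑ γ, ∑ δ, ∑ ρ, ∑ σ, b γ δ * b ρ σ * (R β δ γ ρ * h σ α + R β δ α ρ * h σ γ))
        - (∑ γ, ∑ δ, ∑ ρ, ∑ σ, b γ δ * b ρ σ *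
            (h β ρ * h δ α * h σ γ - h β γ * h δ ρ * h σ α)))
      J t := by
  obtain hJ' | hJ' := J.subsingleton_or_nontrivial
  · exact HasFDerivWithinAt.of_subsingleton hJ'
  obtain ⟨V, hV, hVe⟩ := extend_target_eq e
  exact hasDerivWithinAt_sff hJ hJ' hV hVe (fun s => metricInChart (g s) e) (hsmooth e he)
    (fun s _ y hy => posDef_metricInChart (g s) he hy) (hflow e he) ht hz α β
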